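/- Let $f,g_1,\dots,g_m:\mathbb R^n\to\mathbb R^n$ be $C^1$ with $f(0)=0$, write $g(x)=(g_1(x),\dots,g_m(x))$, and for a function $W$ and a vector field $X$ put $L_XW(x)=\nabla W(x)X(x)$ and $L_gW=(L_{g_1}W,\dots,L_{g_m}W)$. Let $V:\mathbb R^n\to\mathbb R$ be $C^\infty$, positive definite and radially unbounded, and let $G:\mathbb R^n\to\mathbb R^n$ be a $C^\infty$ vector field. Assume: 1. $L_fV(x)\le 0$ for all $x\in\mathbb R^n$; 2. if $L_gV(x)=0$ and $x\ne 0$, then $L_fL_GV(x)<0$ or $L_fV(x)<0$; 3. there is a $C^\infty$, positive, nondecreasing function $\mathcal D:[0,\infty)\to(0,\infty)$ with $\int_0^{\infty}\frac{ds}{\mathcal D(s)}=+\infty$ and $|L_gV(x)|\le\mathcal D(V(x))$ for all $x\in\mathbb R^n$. Then for every $\varepsilon>0$ there are $C^\infty$ functions $\delta,\xi:[0,\infty)\to[0,\infty)$ such that, with $K(x):=-\xi(V(x))L_gV(x)^\top$: (i) the system $\dot x=F(x,d):=f(x)+g(x)[K(x)+d]$ is integral-input-to-state stable (iISS), and, with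 $U(x)=V(x)+\delta(V(x))L_GV(x)\ge 0$, the function $$\tilde U(x)=\int_0^{U(x)}\frac{dp}{\mathcal D(p)}$$ is a smooth iISS-CLF for this system; (ii) $|K(x)|\le\varepsilon$ for all $x\in\mathbb R^n$. Here $\dot x=F(x,d)$ is *iISS* if there are $\beta\in\mathcal{KL}$ and $\alpha,\gamma\in\mathcal K_\infty$ such that for every measurable, locally essentially bounded $\mathbf d:[0,\infty)\to\mathbb R^m$ and every initial state, the trajectories of $\dot x(t)=F(x(t),\mathbf d(t))$ exist for all $t\ge 0$ and satisfy $$\alpha(|x(t)|)\le\beta(|x(0)|,t)+\int_0^t\gamma(|\mathbf d(s)|)\,ds\qquad\text{for all } t\ge 0.$$ A *smooth iISS-CLF* for $\dot x=F(x,d)$ is a $C^\infty$, positive definite, radially unbounded function $W:\mathbb R^n\to\mathbb R$ for which there are a continuous positive definite $\alpha_5:[0,\infty)\to[0,\infty)$ and a $\sigma\in\mathcal K$ with $\nabla W(x)F(x,d)\le-\alpha_5(|x|)+\sigma(|d|)$ for all $x\in\mathbb R^n$ and $d\in\mathbb R^m$. -/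

import Mathlib

open Set Filter Topology MeasureTheory
open scoped ContDiff

/-- Euclidean space `ℝ^k` with its Euclidean norm. -/
abbrev Euc (k : ℕ) : Type := EuclideanSpace ℝ (Fin k)

/-- The Lie derivative `L_X W (x) = ∇W(x) X(x)` of a function along a vector field. -/
noncomputable def lieD {n : ℕ} (X : Euc n → Euc n) (W : Euc n → ℝ) (x : Euc n) : ℝ :=
  fderiv ℝ W x (X x)

/-- `L_g W (x)^⊤ = (L_{g_1} W (x), …, L_{g_m} W (x))^⊤`, a vector of `ℝ^m`,
for `g = (g_1, …, g_m)`. -/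
noncomputable def lieDVec {n m : ℕ} (g : Fin m → Euc n → Euc n) (W : Euc n → ℝ) (x : Euc n) :
    Euc m :=
  WithLp.toLp 2 (fun i => lieD (g i) W x)

/-- `g(x) u = ∑ u_i g_i(x)`. -/
noncomputable def inputMap {n m : ℕ} (g : Fin m → Euc n → Euc n) (x : Euc n) (u : Euc m) :
    Euc n :=
  ∑ i, u i • g i x

/-- `W(0) = 0` and `W(x) > 0` for `x ≠ 0`. -/
def PosDefFun {n : ℕ} (W : Euc n → ℝ) : Prop :=
  W 0 = 0 ∧ ∀ x, x ≠ 0 → 0 < W x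

/-- `W(x) → +∞` as `|x| → ∞`. -/
def RadiallyUnbounded {n : ℕ} (W : Euc n → ℝ) : Prop :=
  Tendsto W (comap (fun x => ‖x‖) atTop) atTop

/-- Class `𝒦`; only the values on `[0, ∞)` matter. -/
structure IsClassK (α : ℝ → ℝ) : Prop where
  continuousOn : ContinuousOn α (Ici 0)
  strictMonoOn : StrictMonoOn α (Ici 0)
  map_zero : α 0 = 0

/-- Class `𝒦_∞`. -/
structure IsClassKInf (α : ℝ → ℝ) : Prop extends IsClassK α where
  tendsto : Tendsto α atTop atTop

/-- Class `𝒦ℒ`; only the values on `[0, ∞) × [0, ∞)` matter. -/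
structure IsClassKL (β : ℝ → ℝ → ℝ) : Prop where
  continuousOn : ContinuousOn (fun p : ℝ × ℝ => β p.1 p.2) (Ici 0 ×ˢ Ici 0)
  classK : ∀ t, 0 ≤ t → IsClassK (fun r => β r t)
  antitoneOn : ∀ r, 0 ≤ r → AntitoneOn (β r) (Ici 0)
  tendsto : ∀ r, 0 ≤ r → Tendsto (β r) atTop (𝓝 0)

/-- Disturbances: (Lebesgue) measurable, locally essentially bounded functions
`[0, ∞) → ℝ^m`. -/
structure IsDisturbance {m : ℕ} (d : ℝ → Euc m) : Prop where
  measurable : AEStronglyMeasurable d (volume.restrict (Ici 0))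
  locallyBounded : ∀ T : ℝ, 0 ≤ T → ∃ M : ℝ, ∀ᵐ s ∂(volume.restrict (Icc 0 T)), ‖d s‖ ≤ M

/-- `x` is a (Carathéodory) trajectory of `x'(t) = F(x(t), d(t))` on `[0, T]`. -/
structure IsTrajectoryOn {n m : ℕ} (F : Euc n → Euc m → Euc n) (d : ℝ → Euc m) (T : ℝ)
    (x : ℝ → Euc n) : Prop where
  continuousOn : ContinuousOn x (Icc 0 T)
  integrable : IntervalIntegrable (fun s => F (x s) (d s)) volume 0 T
  eq_integral : ∀ t ∈ Icc 0 T, x t = x 0 + ∫ s in (0 : ℝ)..t, F (x s) (d s)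

/-- Integral-input-to-state stability of `x' = F(x, d)`: for all initial states and disturbances
there is a trajectory defined for all `t ≥ 0`, and every trajectory, on whatever time interval it
is defined, obeys the iISS estimate, with `β`, `α`, `γ` that depend on the system only. -/
def IsIISS {n m : ℕ} (F : Euc n → Euc m → Euc n) : Prop :=
  (∀ d : ℝ → Euc m, IsDisturbance d → ∀ x₀ : Euc n,
    ∃ x : ℝ → Euc n, x 0 = x₀ ∧ ∀ T, 0 ≤ T → IsTrajectoryOn F d T x) ∧
  ∃ (β : ℝ → ℝ → ℝ) (α γ : ℝ → ℝ), IsClassKL β ∧ IsClassKInf α ∧ IsClassKInf γ ∧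
    ∀ d : ℝ → Euc m, IsDisturbance d → ∀ T, 0 ≤ T → ∀ x : ℝ → Euc n, IsTrajectoryOn F d T x →
      ∀ t ∈ Icc 0 T, α ‖x t‖ ≤ β ‖x 0‖ t + ∫ s in (0 : ℝ)..t, γ ‖d s‖

/-- `W` is a smooth iISS-CLF (iISS Lyapunov function) for `x' = F(x, d)`: it is smooth, positive
definite and radially unbounded, and `∇W(x) F(x, d) ≤ -α(|x|) + σ(|d|)` for some continuous
positive definite `α` and some `σ` of class `𝒦`. -/
structure IsSmoothIISSCLF {n m : ℕ} (F : Euc n → Euc m → Euc n) (W : Euc n → ℝ) : Prop where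
  smooth : ContDiff ℝ ∞ W
  posDef : PosDefFun W
  radiallyUnbounded : RadiallyUnbounded W
  decay : ∃ α σ : ℝ → ℝ, ContinuousOn α (Ici 0) ∧ α 0 = 0 ∧ (∀ r, 0 < r → 0 < α r) ∧
    IsClassK σ ∧ ∀ (x : Euc n) (d : Euc m), fderiv ℝ W x (F x d) ≤ -α ‖x‖ + σ ‖d‖

/-- The feedback `K(x) = -ξ(V(x)) L_g V(x)^⊤`. -/
noncomputable def feedbackK {n m : ℕ} (g : Fin m → Euc n → Euc n) (V : Euc n → ℝ) (ξ : ℝ → ℝ)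
    (x : Euc n) : Euc m :=
  -(ξ (V x) • lieDVec g V x)

/-- The system `x' = f(x) + g(x) (K(x) + d)` with actuator error `d`. -/
noncomputable def actuatorSystem {n m : ℕ} (f : Euc n → Euc n) (g : Fin m → Euc n → Euc n)
    (K : Euc n → Euc m) (x : Euc n) (d : Euc m) : Euc n :=
  f x + inputMap g x (K x + d)

/-- `U = V + δ(V) L_G V`. -/
noncomputable def candidateU {n : ℕ} (V : Euc n → ℝ) (G : Euc n → Euc n) (δ : ℝ → ℝ)
    (x : Euc n) : ℝ :=
  V x + δ (V x) * lieD G V x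

/-! Take `ξ = ε / D`; then `|L_gV| ≤ D(V)` gives `|K| ≤ ε`. Along the undisturbed closed loop, `V`
has derivative `L_fV - ξ(V)|L_gV|² ≤ 0`. Away from the origin this vanishes only where `L_fV = 0`
and `L_gV = 0`, and there `L_fL_GV < 0`. The derivative of `U = V + δ(V) L_GV` is `(1 + δ'(V) L_GV)`
times that of `V`, plus `δ(V)` times `L_fL_GV - ξ(V)⟨L_gL_GV, L_gV⟩`. At a degenerate point the
second term is negative for every positive weight; elsewhere the first is negative and survives
small `δ`, `δ'`. Compactness of the shells `a ≤ V ≤ b` makes the admissible size uniform on each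
shell, and a smooth `δ`, flat at `0`, can be fitted below all these thresholds
(`exists_flat_weight`).

The same smallness keeps `U ≥ V/2`, `D(V) ≤ 2D(U)` and the input gain of `U` of order `D(V)`.
Dividing by `D(U)`, which is what passing to `∫ dp/D(p)` does, leaves a gain linear in `|d|`;
divergence of the integral keeps the new function proper.

iISS then follows from a dissipation inequality `W' ≤ -α(|x|) + c|d|` (`isIISS_of_dissipation`).
Subtracting the accumulated input `v = ∫ c|d|` leaves a decreasing `y = W - v`. Either `W ≤ 2v`, or
`W/2 ≤ y ≤ W` up to the present time and `y` decays at a rate depending on `y` alone, to which the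
comparison principle applies. Global existence comes from the a priori bound on `W` and a cutoff. -/

/-! ### Smooth flat functions below prescribed thresholds -/

/-- A smooth function on the line that vanishes on `(-∞, 0]`, is positive on `(0, ∞)`, and is so
small together with its derivative that it meets a prescribed local smallness condition. -/
theorem exists_contDiff_flat_of_locally_small (P : ℝ → ℝ → ℝ → Prop)
    (hP : ∀ a b : ℝ, 0 < a → ∃ c > 0, ∀ s ∈ Icc a b, ∀ p q : ℝ, 0 < p → p ≤ c → |q| ≤ c → P s p q) :
    ∃ δ : ℝ → ℝ, ContDiff ℝ ∞ δ ∧ (∀ s ≤ 0, δ s = 0) ∧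
      ∀ s, 0 < s → 0 < δ s ∧ P s (δ s) (deriv δ s) := by
  have hI : ∀ k : ℕ, ∃ φ : ℝ → ℝ, φ.support = Ioo (1 / ((k : ℝ) + 2)) (k + 2) ∧
      ContDiff ℝ ∞ φ ∧ range φ ⊆ Icc 0 1 := fun k => isOpen_Ioo.exists_contDiff_support_eq (n := ⊤)
  choose φ φ_supp φ_smooth φ_range using hI
  have φ_nonneg : ∀ k s, 0 ≤ φ k s := fun k s => (φ_range k (mem_range_self s)).1
  have φ_comp : ∀ k, HasCompactSupport (φ k) := fun k =>
    HasCompactSupport.of_support_subset_isCompact isCompact_Icc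
      ((φ_supp k).le.trans Ioo_subset_Icc_self)
  choose c c_pos hc using fun k : ℕ => hP (1 / ((k : ℝ) + 2)) (k + 2) (by positivity)
  -- Running minima: every bump with index at least `j` then respects the threshold `c j`. As the
  -- weights `η` sum to less than 1, so does the whole series.
  let e : ℕ → ℝ := fun k => (Finset.range (k + 1)).inf' (by simp) c
  have e_pos : ∀ k, 0 < e k := fun k => by
    simp only [e, Finset.lt_inf'_iff]
    exact fun i _ => c_pos i
  have e_le : ∀ j k, j ≤ k → e k ≤ c j := fun j k hjk =>
    Finset.inf'_le _ (by simpa using Nat.lt_succ_of_le hjk)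
  obtain ⟨η, η_pos, S, hS, S_lt⟩ :
      ∃ η : ℕ → NNReal, (∀ i, 0 < η i) ∧ ∃ S : NNReal, HasSum η S ∧ S < 1 :=
    NNReal.exists_pos_sum_of_countable one_ne_zero ℕ
  have hη : HasSum (fun k => (η k : ℝ)) S := NNReal.hasSum_coe.2 hS
  -- Bump `k` is controlled up to order `k + 1`: each fixed order is covered for all but finitely
  -- many `k`, and orders 0 and 1 for every `k`.
  have hr : ∀ k : ℕ, ∃ r : ℝ, 0 < r ∧ ∀ i ≤ k + 1, ∀ s,
      ‖iteratedFDeriv ℝ i (fun s => r * φ k s) s‖ ≤ η k * min 1 (e k) := by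
    intro k
    have hb : ∀ i, ∃ R, ∀ s, ‖iteratedFDeriv ℝ i (φ k) s‖ ≤ R := fun i => by
      have : BddAbove (range fun s => ‖iteratedFDeriv ℝ i (φ k) s‖) :=
        ((φ_smooth k).continuous_iteratedFDeriv (mod_cast le_top)).norm.bddAbove_range_of_hasCompactSupport
          (((φ_comp k).iteratedFDeriv i).comp_left norm_zero)
      obtain ⟨R, hR⟩ := this
      exact ⟨R, fun s => hR (mem_range_self s)⟩
    choose R hR using hb
    have hM : ∀ i ≤ k + 1, R i ≤ ∑ j ∈ Finset.range (k + 2), |R j| := fun i hi =>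
      (le_abs_self _).trans (Finset.single_le_sum (f := fun j => |R j|)
        (fun j _ => abs_nonneg _) (by simp; lia))
    set M := 1 + ∑ j ∈ Finset.range (k + 2), |R j|
    have M_pos : 0 < M := by positivity
    have hm : 0 < η k * min 1 (e k) := mul_pos (η_pos k) (lt_min one_pos (e_pos k))
    refine ⟨M⁻¹ * (η k * min 1 (e k)), by positivity, fun i hi s => ?_⟩
    have h1 : iteratedFDeriv ℝ i ((M⁻¹ * (η k * min 1 (e k))) • φ k) s
        = (M⁻¹ * (η k * min 1 (e k))) • iteratedFDeriv ℝ i (φ k) s :=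
      iteratedFDeriv_const_smul_apply ((φ_smooth k).contDiffAt.of_le (mod_cast le_top))
    change ‖iteratedFDeriv ℝ i ((M⁻¹ * (η k * min 1 (e k))) • φ k) s‖ ≤ _
    rw [h1, norm_smul, Real.norm_of_nonneg (by positivity)]
    calc M⁻¹ * (η k * min 1 (e k)) * ‖iteratedFDeriv ℝ i (φ k) s‖
        ≤ M⁻¹ * (η k * min 1 (e k)) * M := by
          gcongr
          exact (hR i s).trans ((hM i hi).trans (by simp [M]))
      _ = η k * min 1 (e k) := by field_simp
  choose r r_pos hr using hr
  have φr_smooth : ∀ k, ContDiff ℝ ∞ (fun s => r k * φ k s) := fun k =>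
    contDiff_const.mul (φ_smooth k)
  have h0 : ∀ k s, r k * φ k s ≤ η k * min 1 (e k) := fun k s => by
    have := hr k 0 (by lia) s
    rw [norm_iteratedFDeriv_zero] at this
    exact (le_abs_self _).trans this
  have h1 : ∀ k s, ‖deriv (fun s => r k * φ k s) s‖ ≤ η k * min 1 (e k) := fun k s => by
    have := hr k 1 (by lia) s
    rwa [norm_iteratedFDeriv_one, ← norm_deriv_eq_norm_fderiv] at this
  have hle : ∀ k, η k * min 1 (e k) ≤ (η k : ℝ) := fun k =>
    mul_le_of_le_one_right (by positivity) (min_le_left _ _)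
  have hnn : ∀ k s, 0 ≤ r k * φ k s := fun k s => mul_nonneg (r_pos k).le (φ_nonneg k s)
  have hsum : ∀ s, Summable fun k => r k * φ k s := fun s =>
    Summable.of_nonneg_of_le (fun k => hnn k s) (fun k => (h0 k s).trans (hle k)) hη.summable
  have hderiv : ∀ s, deriv (fun s => ∑' k, r k * φ k s) s = ∑' k, deriv (fun s => r k * φ k s) s := by
    intro s
    exact deriv_tsum_apply hη.summable
      (fun k y => ((φr_smooth k).differentiable (by simp)).differentiableAt)
      (fun k y => (h1 k y).trans (hle k)) (hsum 0) s
  have hzero : ∀ (k : ℕ) (s : ℝ), s ∉ Ioo (1 / ((k : ℝ) + 2)) (k + 2) → φ k s = 0 := fun k s hs => by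
    rw [← φ_supp k] at hs
    simpa using hs
  refine ⟨fun s => ∑' k, r k * φ k s, ?_, fun s hs => ?_, fun s hs => ?_⟩
  · refine contDiff_tsum_of_eventually φr_smooth (fun k _ => hη.summable) fun i _ => ?_
    simp only [Nat.cofinite_eq_atTop, eventually_atTop]
    exact ⟨i, fun k hk s => (hr k i (by lia) s).trans (hle k)⟩
  · have : ∀ k, φ k s = 0 := fun k => hzero k s fun h => by
      have : (0 : ℝ) < 1 / ((k : ℝ) + 2) := by positivity
      linarith [h.1]
    simp [this]
  · have hex : ∃ k : ℕ, s ∈ Ioo (1 / ((k : ℝ) + 2)) (k + 2) := by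
      obtain ⟨k, hk⟩ := exists_nat_gt (max s (1 / s))
      have hk1 := (le_max_left _ _).trans_lt hk
      have hk2 := (le_max_right _ _).trans_lt hk
      refine ⟨k, ?_, by linarith⟩
      rw [div_lt_iff₀ (by positivity)]
      rw [div_lt_iff₀ hs] at hk2
      nlinarith
    classical
    -- With `j` the first interval containing `s`, earlier bumps vanish at `s`. Being nonnegative
    -- they have a minimum there, so their derivatives vanish too.
    set j := Nat.find hex
    have hj : s ∈ Ioo (1 / ((j : ℝ) + 2)) (j + 2) := Nat.find_spec hex
    have hlt : ∀ k < j, φ k s = 0 := fun k hk => hzero k s (Nat.find_min hex hk)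
    have hbd : ∀ k, r k * φ k s ≤ η k * c j := fun k => by
      rcases lt_or_ge k j with hk | hk
      · rw [hlt k hk, mul_zero]
        exact mul_nonneg (by positivity) (c_pos j).le
      · exact (h0 k s).trans (mul_le_mul_of_nonneg_left
          ((min_le_right _ _).trans (e_le j k hk)) (by positivity))
    have hbd' : ∀ k, ‖deriv (fun s => r k * φ k s) s‖ ≤ η k * c j := fun k => by
      rcases lt_or_ge k j with hk | hk
      · have : IsLocalMin (fun s => r k * φ k s) s :=
          Filter.Eventually.of_forall fun y => by
            simpa [hlt k hk] using hnn k y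
        rw [this.deriv_eq_zero, norm_zero]
        exact mul_nonneg (by positivity) (c_pos j).le
      · exact (h1 k s).trans (mul_le_mul_of_nonneg_left
          ((min_le_right _ _).trans (e_le j k hk)) (by positivity))
    have hSc : (S : ℝ) * c j ≤ c j := mul_le_of_le_one_left (c_pos j).le (by exact_mod_cast S_lt.le)
    have hpos : 0 < ∑' k, r k * φ k s := (hsum s).tsum_pos (fun k => hnn k s) j
      (mul_pos (r_pos j) (lt_of_le_of_ne (φ_nonneg j s) (Ne.symm (by
        rw [← φ_supp j] at hj
        exact hj))))
    refine ⟨hpos, hc j s (Ioo_subset_Icc_self hj) _ _ hpos ?_ ?_⟩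
    · exact ((hsum s).tsum_le_tsum hbd (hη.mul_right (c j)).summable).trans
        ((hη.mul_right (c j)).tsum_eq.le.trans hSc)
    · rw [hderiv s]
      exact (tsum_of_norm_bounded (hη.mul_right (c j)) hbd').trans hSc

/-! ### Comparison functions for positive definite functions -/

/-- An infimum of nonnegative functions of the form `W i + θ i` with each `θ i` Lipschitz with
constant `1` is Lipschitz with constant `1`. -/
theorem lipschitzWith_one_iInf {ι : Type*} [Nonempty ι] (W : ι → ℝ) (θ : ι → ℝ → ℝ)
    (h0 : ∀ i y, 0 ≤ W i + θ i y) (hθ : ∀ i y z, θ i y ≤ θ i z + |y - z|) :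
    LipschitzWith 1 fun y => ⨅ i, (W i + θ i y) := by
  have hb : ∀ y, BddBelow (range fun i => W i + θ i y) := fun y => ⟨0, by
    rintro _ ⟨i, rfl⟩
    exact h0 i y⟩
  refine LipschitzWith.of_le_add fun y z => ?_
  rw [← sub_le_iff_le_add]
  refine le_ciInf fun i => ?_
  rw [sub_le_iff_le_add]
  refine (ciInf_le (hb y) i).trans ?_
  rw [Real.dist_eq]
  linarith [hθ i y z]

theorem RadiallyUnbounded.isCompact_preimage_Icc {n : ℕ} {P : Euc n → ℝ} (hP : Continuous P)
    (hPu : RadiallyUnbounded P) (a b : ℝ) : IsCompact (P ⁻¹' Icc a b) := by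
  have h := hPu.eventually (eventually_gt_atTop b)
  rw [eventually_comap] at h
  obtain ⟨R, hR⟩ := eventually_atTop.1 h
  refine (isCompact_closedBall (0 : Euc n) R).of_isClosed_subset (isClosed_Icc.preimage hP) ?_
  intro x hx
  rw [mem_closedBall_zero_iff]
  by_contra hlt
  exact absurd hx.2 (not_le.2 (hR ‖x‖ (not_le.1 hlt).le x rfl))

theorem radiallyUnbounded_iff {n : ℕ} {P : Euc n → ℝ} :
    RadiallyUnbounded P ↔ ∀ M, ∃ R, ∀ x, R ≤ ‖x‖ → M ≤ P x := by
  rw [RadiallyUnbounded, tendsto_atTop]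
  refine forall_congr' fun M => ?_
  rw [eventually_comap, eventually_atTop]
  exact ⟨fun ⟨R, h⟩ => ⟨R, fun x hx => h _ hx x rfl⟩,
    fun ⟨R, h⟩ => ⟨R, fun r hr x hx => h x (hx ▸ hr)⟩⟩

/-- A positive definite function dominates a Lipschitz positive definite function of any point
between half of and all of a proper positive definite function. -/
theorem exists_lipschitz_posDef_minorant {n : ℕ} {W P : Euc n → ℝ} (hW : Continuous W)
    (hWpos : PosDefFun W) (hP : Continuous P) (hPpos : PosDefFun P) (hPu : RadiallyUnbounded P) :
    ∃ ρ : ℝ → ℝ, LipschitzWith 1 ρ ∧ ρ 0 = 0 ∧ (∀ r, 0 < r → 0 < ρ r) ∧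
      ∀ x y, P x / 2 ≤ y → y ≤ P x → ρ y ≤ W x := by
  have hW0 : ∀ x, 0 ≤ W x := fun x => by
    rcases eq_or_ne x 0 with rfl | hx
    · exact hWpos.1.ge
    · exact (hWpos.2 x hx).le
  -- The penalty is the distance from `y` to `[P x / 2, P x]`, so the infimum of `W x + θ x y` is
  -- Lipschitz in `y` and at most `W x` on that interval.
  let θ : Euc n → ℝ → ℝ := fun x y => max 0 (max (y - P x) (P x / 2 - y))
  have hθ0 : ∀ x y, 0 ≤ θ x y := fun x y => le_max_left _ _
  have hb : ∀ y, BddBelow (range fun x => W x + θ x y) := fun y => ⟨0, by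
    rintro _ ⟨x, rfl⟩
    exact add_nonneg (hW0 x) (hθ0 x y)⟩
  refine ⟨fun y => ⨅ x, (W x + θ x y), ?_, ?_, fun r hr => ?_, fun x y h1 h2 => ?_⟩
  · refine lipschitzWith_one_iInf W θ (fun x y => add_nonneg (hW0 x) (hθ0 x y)) fun x y z => ?_
    have h1 := le_abs_self (y - z)
    have h2 := neg_abs_le (y - z)
    refine max_le (add_nonneg (hθ0 x z) (abs_nonneg _)) (max_le ?_ ?_)
    · have : z - P x ≤ θ x z := (le_max_left _ _).trans (le_max_right _ _)
      linarith
    · have : P x / 2 - z ≤ θ x z := (le_max_right _ _).trans (le_max_right _ _)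
      linarith
  · refine le_antisymm ((ciInf_le (hb 0) 0).trans ?_)
      (le_ciInf fun x => add_nonneg (hW0 x) (hθ0 x 0))
    simp [θ, hWpos.1, hPpos.1]
  -- On this compact shell, which avoids the origin, `W` is bounded below; off it the penalty at `r`
  -- exceeds `r / 4`.
  · have hc : ∃ c > 0, ∀ x ∈ P ⁻¹' Icc (3 * r / 4) (5 * r / 2), c ≤ W x := by
      rcases (P ⁻¹' Icc (3 * r / 4) (5 * r / 2)).eq_empty_or_nonempty with he | hne
      · exact ⟨1, one_pos, by simp [he]⟩
      · obtain ⟨x₀, hx₀, hmin⟩ := (hPu.isCompact_preimage_Icc hP (3 * r / 4)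
          (5 * r / 2)).exists_isMinOn hne hW.continuousOn
        refine ⟨W x₀, hWpos.2 x₀ ?_, fun x hx => hmin hx⟩
        rintro rfl
        have := hx₀.1
        rw [hPpos.1] at this
        linarith
    obtain ⟨c, c_pos, hc⟩ := hc
    have : min c (r / 4) ≤ ⨅ x, (W x + θ x r) := by
      refine le_ciInf fun x => ?_
      by_cases hx : x ∈ P ⁻¹' Icc (3 * r / 4) (5 * r / 2)
      · exact (min_le_left _ _).trans ((hc x hx).trans (le_add_of_nonneg_right (hθ0 x r)))
      · refine (min_le_right _ _).trans (le_trans ?_ (le_add_of_nonneg_left (hW0 x)))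
        rw [mem_preimage, mem_Icc, not_and_or, not_le, not_le] at hx
        rcases hx with hx | hx
        · have : r - P x ≤ θ x r := (le_max_left _ _).trans (le_max_right _ _)
          linarith
        · have : P x / 2 - r ≤ θ x r := (le_max_right _ _).trans (le_max_right _ _)
          linarith
    exact (lt_min c_pos (by positivity)).trans_le this
  · refine (ciInf_le (hb y) x).trans ?_
    have : θ x y = 0 := max_eq_left (max_le (by linarith) (by linarith))
    rw [this, add_zero]

theorem posDefFun_norm (n : ℕ) : PosDefFun (fun x : Euc n => ‖x‖) :=
  ⟨norm_zero, fun _ hx => norm_pos_iff.2 hx⟩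

theorem radiallyUnbounded_norm (n : ℕ) : RadiallyUnbounded (fun x : Euc n => ‖x‖) :=
  tendsto_comap

theorem PosDefFun.nonneg {n : ℕ} {W : Euc n → ℝ} (hW : PosDefFun W) (x : Euc n) : 0 ≤ W x := by
  rcases eq_or_ne x 0 with rfl | hx
  · exact hW.1.ge
  · exact (hW.2 x hx).le

/-- The infimum of `P x + max 0 (r - ‖x‖)` is continuous, nondecreasing and proper in `r`, and lies
below `P` at `r = ‖x‖`. The factor `r / (1 + r) ≤ 1` makes it strictly increasing. -/
theorem exists_classKInf_le {n : ℕ} {P : Euc n → ℝ} (hP : Continuous P) (hPpos : PosDefFun P)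
    (hPu : RadiallyUnbounded P) : ∃ α : ℝ → ℝ, IsClassKInf α ∧ ∀ x, α ‖x‖ ≤ P x := by
  let θ : Euc n → ℝ → ℝ := fun x r => max 0 (r - ‖x‖)
  have hθ0 : ∀ x y, 0 ≤ θ x y := fun x y => le_max_left _ _
  have hnn : ∀ y x, 0 ≤ P x + θ x y := fun y x => add_nonneg (hPpos.nonneg x) (hθ0 x y)
  have hb : ∀ y, BddBelow (range fun x => P x + θ x y) := fun y => ⟨0, by
    rintro _ ⟨x, rfl⟩
    exact hnn y x⟩
  let μ : ℝ → ℝ := fun r => ⨅ x, (P x + θ x r)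
  have hμ : LipschitzWith 1 μ := by
    refine lipschitzWith_one_iInf P θ (fun x y => hnn y x) fun x y z => ?_
    have h1 := le_abs_self (y - z)
    refine max_le (add_nonneg (hθ0 x z) (abs_nonneg _)) ?_
    have : z - ‖x‖ ≤ θ x z := le_max_right _ _
    linarith
  have hμ_mono : Monotone μ := fun r s hrs => le_ciInf fun x => (ciInf_le (hb r) x).trans
    (by simp only [θ]; gcongr)
  have hμ_nonneg : ∀ r, 0 ≤ μ r := fun r => le_ciInf (hnn r)
  have hμ_pos : ∀ r, 0 < r → 0 < μ r := fun r hr => by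
    have hc : ∃ c > 0, ∀ x : Euc n, r / 2 ≤ ‖x‖ → c ≤ P x := by
      obtain ⟨R, hR⟩ := radiallyUnbounded_iff.1 hPu 1
      rcases (Metric.closedBall (0 : Euc n) R ∩ {x | r / 2 ≤ ‖x‖}).eq_empty_or_nonempty
        with he | hne
      · refine ⟨1, one_pos, fun x hx => hR x (not_lt.1 fun h => ?_)⟩
        exact he.le ⟨mem_closedBall_zero_iff.2 h.le, hx⟩
      · obtain ⟨x₀, hx₀, hmin⟩ := ((isCompact_closedBall (0 : Euc n) R).inter_right
          (isClosed_le continuous_const continuous_norm)).exists_isMinOn hne hP.continuousOn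
        have hx₀' : r / 2 ≤ ‖x₀‖ := hx₀.2
        refine ⟨min 1 (P x₀), lt_min one_pos (hPpos.2 x₀ fun h => ?_), fun x hx => ?_⟩
        · rw [h, norm_zero] at hx₀'
          linarith
        · rcases le_or_gt R ‖x‖ with h | h
          · exact (min_le_left _ _).trans (hR x h)
          · exact (min_le_right _ _).trans (hmin ⟨mem_closedBall_zero_iff.2 h.le, hx⟩)
    obtain ⟨c, c_pos, hc⟩ := hc
    refine (lt_min c_pos (half_pos hr)).trans_le (le_ciInf fun x => ?_)
    rcases le_or_gt (r / 2) ‖x‖ with h | h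
    · exact (min_le_left _ _).trans ((hc x h).trans (le_add_of_nonneg_right (hθ0 x r)))
    · refine (min_le_right _ _).trans (le_trans ?_ (le_add_of_nonneg_left (hPpos.nonneg x)))
      exact le_trans (by linarith) (le_max_right 0 (r - ‖x‖))
  have hμ_top : Tendsto μ atTop atTop := by
    refine tendsto_atTop.2 fun M => ?_
    obtain ⟨R, hR⟩ := radiallyUnbounded_iff.1 hPu M
    filter_upwards [eventually_ge_atTop (R + M)] with r hr
    refine le_ciInf fun x => ?_
    rcases le_or_gt R ‖x‖ with h | h
    · exact (hR x h).trans (le_add_of_nonneg_right (hθ0 x r))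
    · refine le_trans ?_ (le_add_of_nonneg_left (hPpos.nonneg x))
      exact le_trans (by linarith) (le_max_right 0 (r - ‖x‖))
  have hq : ∀ r : ℝ, 0 ≤ r → r / (1 + r) = 1 - 1 / (1 + r) := fun r hr => by
    field_simp
    ring
  refine ⟨fun r => μ r * (r / (1 + r)), ⟨⟨?_, ?_, by simp⟩, ?_⟩, fun x => ?_⟩
  · refine hμ.continuous.continuousOn.mul (continuousOn_id.div
      (continuousOn_const.add continuousOn_id) fun r hr => ?_)
    have : (0 : ℝ) ≤ r := hr
    positivity
  · intro r hr s hs hrs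
    have hr' : (0 : ℝ) ≤ r := hr
    have hs' : 0 < s := hr'.trans_lt hrs
    have h1 : r / (1 + r) < s / (1 + s) := by
      rw [div_lt_div_iff₀ (by linarith) (by linarith)]
      nlinarith
    calc μ r * (r / (1 + r)) ≤ μ s * (r / (1 + r)) :=
          mul_le_mul_of_nonneg_right (hμ_mono hrs.le) (by positivity)
      _ < μ s * (s / (1 + s)) := mul_lt_mul_of_pos_left h1 (hμ_pos s hs')
  · refine tendsto_atTop_mono' _ ?_ (hμ_top.atTop_mul_const (r := 1 / 2) (by norm_num))
    filter_upwards [eventually_ge_atTop 1] with r hr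
    refine mul_le_mul_of_nonneg_left ?_ (hμ_nonneg r)
    rw [div_le_div_iff₀ (by norm_num) (by linarith)]
    linarith
  · have h1 : μ ‖x‖ ≤ P x := (ciInf_le (hb ‖x‖) x).trans (by simp [θ])
    have h2 : ‖x‖ / (1 + ‖x‖) ≤ 1 := (div_le_one (by positivity)).2 (by linarith)
    exact (mul_le_of_le_one_right (hμ_nonneg _) h2).trans h1

/-- The maximum of `P` over the ball of radius `r` is written as a supremum of `P (r • z)` over the
fixed unit ball, so compactness gives continuity in `r`. Adding `r` makes it strictly increasing. -/
theorem exists_classK_ge {n : ℕ} {P : Euc n → ℝ} (hP : Continuous P) (hP0 : P 0 = 0) :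
    ∃ α : ℝ → ℝ, Continuous α ∧ IsClassK α ∧ ∀ x, P x ≤ α ‖x‖ := by
  let f : ℝ → Euc n → ℝ := fun r z => P (r • z)
  have hf : Continuous (Function.uncurry f) := hP.comp (continuous_fst.smul continuous_snd)
  have hK := isCompact_closedBall (0 : Euc n) 1
  have hcont : Continuous fun r => sSup (f r '' Metric.closedBall 0 1) := hK.continuous_sSup hf
  have hbdd : ∀ r, BddAbove (f r '' Metric.closedBall 0 1) := fun r =>
    hK.bddAbove_image (hf.comp (Continuous.prodMk_right r)).continuousOn
  have hle : ∀ r, 0 ≤ r → ∀ x, ‖x‖ ≤ r → P x ≤ sSup (f r '' Metric.closedBall 0 1) := by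
    intro r hr x hx
    refine le_csSup (hbdd r) ?_
    rcases hr.eq_or_lt with rfl | hr
    · exact ⟨0, by simp, by simp [f, norm_le_zero_iff.1 hx]⟩
    · refine ⟨r⁻¹ • x, ?_, by simp [f, smul_smul, hr.ne']⟩
      rw [mem_closedBall_zero_iff, norm_smul, norm_inv, Real.norm_of_nonneg hr.le]
      exact inv_mul_le_one_of_le₀ hx hr.le
  have hne : ∀ r, (f r '' Metric.closedBall 0 1).Nonempty := fun r => ⟨_, 0, by simp, rfl⟩
  refine ⟨fun r => sSup (f r '' Metric.closedBall 0 1) + r, hcont.add continuous_id,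
    ⟨(hcont.add continuous_id).continuousOn, ?_, ?_⟩, fun x => ?_⟩
  · intro r hr s hs hrs
    refine add_lt_add_of_le_of_lt (csSup_le (hne r) ?_) hrs
    rintro _ ⟨z, hz, rfl⟩
    refine hle s hs _ ?_
    rw [norm_smul, Real.norm_of_nonneg hr]
    exact (mul_le_of_le_one_right hr (mem_closedBall_zero_iff.1 hz)).trans hrs.le
  · have : f 0 '' Metric.closedBall 0 1 = {0} := by
      refine (hne 0).subset_singleton_iff.1 ?_
      rintro _ ⟨z, -, rfl⟩
      simp [f, hP0]
    simp [this]
  · exact (hle ‖x‖ (norm_nonneg x) x le_rfl).trans (le_add_of_nonneg_right (norm_nonneg x))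

/-! ### The chain rule along absolutely continuous curves -/

theorem AbsolutelyContinuousOnInterval.of_dist_le {X Y : Type*} [PseudoMetricSpace X]
    [PseudoMetricSpace Y] {f : ℝ → X} {g : ℝ → Y} {a b : ℝ} (K : ℝ)
    (hg : AbsolutelyContinuousOnInterval g a b)
    (hfg : ∀ s ∈ uIcc a b, ∀ t ∈ uIcc a b, dist (f s) (f t) ≤ K * dist (g s) (g t)) :
    AbsolutelyContinuousOnInterval f a b := by
  have h := Tendsto.const_mul K hg
  rw [mul_zero] at h
  refine squeeze_zero' (Eventually.of_forall fun E => Finset.sum_nonneg fun _ _ => dist_nonneg)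
    ?_ h
  have : ∀ᶠ E : ℕ × (ℕ → ℝ × ℝ) in totalLengthFilter ⊓ 𝓟 (disjWithin a b), E ∈ disjWithin a b :=
    eventually_inf_principal.mpr (by simp)
  filter_upwards [this] with E hE
  rw [Finset.mul_sum]
  exact Finset.sum_le_sum fun i hi => hfg _ (hE.1 i hi).1 _ (hE.1 i hi).2

/-- The fundamental theorem of calculus for a continuously differentiable function along an
absolutely continuous curve. -/
theorem integral_fderiv_comp_eq_sub {E : Type*} [NormedAddCommGroup E] [NormedSpace ℝ E]
    [FiniteDimensional ℝ E] {W : E → ℝ} (hW : ContDiff ℝ 1 W) {x h : ℝ → E} {T : ℝ}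
    (hxc : ContinuousOn x (Icc 0 T)) (hh : IntervalIntegrable h volume 0 T)
    (hx : ∀ t ∈ Icc 0 T, x t = x 0 + ∫ s in (0 : ℝ)..t, h s) {a b : ℝ} (ha : 0 ≤ a) (hab : a ≤ b)
    (hb : b ≤ T) :
    IntervalIntegrable (fun s => fderiv ℝ W (x s) (h s)) volume a b ∧
      ∫ s in a..b, fderiv ℝ W (x s) (h s) = W (x b) - W (x a) := by
  have : CompleteSpace E := FiniteDimensional.complete ℝ E
  have hsub : Icc a b ⊆ Icc 0 T := Icc_subset_Icc ha hb
  have hT : 0 ≤ T := ha.trans (hab.trans hb)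
  have hint : ∀ c ∈ Icc 0 T, ∀ e ∈ Icc 0 T, IntervalIntegrable h volume c e := fun c hc e he =>
    hh.mono_set (by
      rw [uIcc_of_le hT]
      exact uIcc_subset_Icc hc he)
  have hdiff : ∀ s ∈ Icc a b, ∀ t ∈ Icc a b, x t - x s = ∫ τ in s..t, h τ := by
    intro s hs t ht
    have h0 : (0 : ℝ) ∈ Icc 0 T := ⟨le_rfl, hT⟩
    rw [hx t (hsub ht), hx s (hsub hs), add_sub_add_left_eq_sub,
      intervalIntegral.integral_interval_sub_left (hint 0 h0 t (hsub ht)) (hint 0 h0 s (hsub hs))]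
  have hhab : IntervalIntegrable h volume a b := hint a (hsub ⟨le_rfl, hab⟩) b (hsub ⟨hab, le_rfl⟩)
  have hnorm : ∀ s ∈ Icc a b, ∀ t ∈ Icc a b, dist (x s) (x t) ≤
      dist (∫ τ in a..s, ‖h τ‖) (∫ τ in a..t, ‖h τ‖) := by
    intro s hs t ht
    have i1 : ∀ s ∈ Icc a b, IntervalIntegrable (fun τ => ‖h τ‖) volume a s := fun s hs =>
      (hint a (hsub ⟨le_rfl, hab⟩) s (hsub hs)).norm
    rw [dist_comm, dist_eq_norm, hdiff s hs t ht, dist_comm, Real.dist_eq,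
      intervalIntegral.integral_interval_sub_left (i1 t ht) (i1 s hs)]
    exact intervalIntegral.norm_integral_le_abs_integral_norm
  -- The curve stays in a ball on which `W` is Lipschitz, so `W ∘ x` inherits absolute continuity
  -- from the primitive of `‖h‖`. The chain rule is then needed only almost everywhere.
  obtain ⟨R, hR⟩ := (isCompact_Icc.image_of_continuousOn hxc).isBounded.subset_closedBall (0 : E)
  obtain ⟨K, hK⟩ := hW.contDiffOn.exists_lipschitzOnWith (by decide)
    (convex_closedBall (0 : E) R) (isCompact_closedBall 0 R)
  have hball : ∀ s ∈ Icc a b, x s ∈ Metric.closedBall (0 : E) R := fun s hs =>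
    hR (mem_image_of_mem x (hsub hs))
  have hac : AbsolutelyContinuousOnInterval (fun s => W (x s)) a b := by
    refine AbsolutelyContinuousOnInterval.of_dist_le K
      (hhab.norm.absolutelyContinuousOnInterval_intervalIntegral left_mem_uIcc) fun s hs t ht => ?_
    rw [uIcc_of_le hab] at hs ht
    exact (hK.dist_le_mul _ (hball s hs) _ (hball t ht)).trans
      (mul_le_mul_of_nonneg_left (hnorm s hs t ht) K.2)
  have hae : ∀ᵐ s, s ∈ uIoc a b → deriv (fun s => W (x s)) s = fderiv ℝ W (x s) (h s) := by
    have hb' : ∀ᵐ s : ℝ, s ≠ b := by simp [ae_iff, measure_singleton]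
    filter_upwards [hhab.ae_hasDerivAt_integral, hb'] with s hs hsb hsmem
    rw [uIoc_of_le hab] at hsmem
    have hsI : s ∈ Ioo a b := ⟨hsmem.1, lt_of_le_of_ne hsmem.2 hsb⟩
    have h1 := (hs (by rw [uIcc_of_le hab]; exact Ioo_subset_Icc_self hsI) a left_mem_uIcc).const_add
      (x a)
    have h2 : HasDerivAt x (h s) s := by
      refine h1.congr_of_eventuallyEq ?_
      filter_upwards [Ioo_mem_nhds hsI.1 hsI.2] with t ht
      rw [← hdiff a ⟨le_rfl, hab⟩ t (Ioo_subset_Icc_self ht)]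
      abel
    exact (((hW.differentiable (by simp)) (x s)).hasFDerivAt.comp_hasDerivAt s h2).deriv
  constructor
  · refine hac.intervalIntegrable_deriv.congr_ae ?_
    exact (ae_restrict_iff' measurableSet_uIoc).2 hae
  · rw [← hac.integral_deriv_eq_sub]
    exact (intervalIntegral.integral_congr_ae hae).symm

/-! ### The comparison principle -/

/-- A positive definite rate with Lipschitz constant `1` has a gauge that turns decay at this rate
into exponential decay. -/
theorem exists_orderIso_gauge {ρ : ℝ → ℝ} (hρ : LipschitzWith 1 ρ) (hρ0 : ρ 0 = 0)
    (hρpos : ∀ r, 0 < r → 0 < ρ r) :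
    ∃ ψ : ℝ ≃o ℝ, ψ 0 = 0 ∧
      ∀ s, 0 < s → 0 < ψ s ∧ HasDerivAt (fun s => Real.log (ψ s)) (1 / ρ s) s := by
  -- This is what the Lipschitz bound is for: `1 / ρ ≥ 1 / s` makes `Φ` diverge at least like `log`
  -- at both ends, so `exp ∘ Φ` maps `(0, ∞)` onto itself.
  have hle : ∀ s, 0 < s → ρ s ≤ s := fun s hs => by
    have := hρ.dist_le_mul s 0
    rw [hρ0, Real.dist_eq, Real.dist_eq, sub_zero, sub_zero, abs_of_pos hs,
      abs_of_pos (hρpos s hs)] at this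
    simpa using this
  have hcont : ContinuousOn (fun s => 1 / ρ s) (Ioi 0) :=
    continuousOn_const.div hρ.continuous.continuousOn fun s hs => (hρpos s hs).ne'
  have hint : ∀ s t, 0 < s → 0 < t → IntervalIntegrable (fun s => 1 / ρ s) volume s t :=
    fun s t hs ht => (hcont.mono fun u hu => (lt_min hs ht).trans_le hu.1).intervalIntegrable
  let Φ : ℝ → ℝ := fun s => ∫ u in (1 : ℝ)..s, 1 / ρ u
  have hΦ : ∀ s, 0 < s → HasDerivAt Φ (1 / ρ s) s := fun s hs =>
    intervalIntegral.integral_hasDerivAt_right (hint 1 s one_pos hs)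
      (hcont.stronglyMeasurableAtFilter isOpen_Ioi s hs) (hcont.continuousAt (Ioi_mem_nhds hs))
  have hcmp : ∀ s t, 0 < s → s ≤ t → Real.log t - Real.log s ≤ Φ t - Φ s := by
    intro s t hs hst
    have ht := hs.trans_le hst
    have h1 : Φ t - Φ s = ∫ u in s..t, 1 / ρ u :=
      intervalIntegral.integral_interval_sub_left (hint 1 t one_pos ht) (hint 1 s one_pos hs)
    rw [h1, ← Real.log_div ht.ne' hs.ne', ← integral_one_div_of_pos hs ht]
    refine intervalIntegral.integral_mono_on hst ?_ (hint s t hs ht) fun u hu => ?_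
    · refine intervalIntegral.intervalIntegrable_one_div (fun u hu => ?_) continuousOn_id
      rw [uIcc_of_le hst] at hu
      exact (hs.trans_le hu.1).ne'
    · have hu0 := hs.trans_le hu.1
      exact one_div_le_one_div_of_le (hρpos u hu0) (hle u hu0)
  have hΦmono : ∀ s t, 0 < s → s < t → Φ s < Φ t := fun s t hs hst => by
    have := hcmp s t hs hst.le
    have := Real.log_lt_log hs hst
    linarith
  have hΦ1 : Φ 1 = 0 := intervalIntegral.integral_same
  -- Continuing by the identity gives an order isomorphism of the whole line, whose inverse is then
  -- automatically continuous.
  let ψ : ℝ → ℝ := fun s => if 0 < s then Real.exp (Φ s) else s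
  have hψpos : ∀ s, 0 < s → ψ s = Real.exp (Φ s) := fun s hs => if_pos hs
  have hψneg : ∀ s, s ≤ 0 → ψ s = s := fun s hs => if_neg hs.not_gt
  have hsmall : ∀ s, 0 < s → s ≤ 1 → ψ s ≤ s := fun s hs h1 => by
    rw [hψpos s hs, ← Real.le_log_iff_exp_le hs]
    have := hcmp s 1 hs h1
    rw [hΦ1, Real.log_one] at this
    linarith
  have hlarge : ∀ s, 1 ≤ s → s ≤ ψ s := fun s h1 => by
    have hs : 0 < s := one_pos.trans_le h1
    rw [hψpos s hs, ← Real.log_le_iff_le_exp hs]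
    have := hcmp 1 s one_pos h1
    rw [hΦ1, Real.log_one] at this
    linarith
  have hmono : StrictMono ψ := by
    intro s t hst
    rcases le_or_gt s 0 with hs | hs
    · rcases le_or_gt t 0 with ht | ht
      · rwa [hψneg s hs, hψneg t ht]
      · rw [hψneg s hs, hψpos t ht]
        exact hs.trans_lt (Real.exp_pos _)
    · rw [hψpos s hs, hψpos t (hs.trans hst)]
      exact Real.exp_lt_exp.2 (hΦmono s t hs hst)
  have hψcont : Continuous ψ := by
    rw [continuous_iff_continuousAt]
    intro s
    rcases lt_trichotomy s 0 with hs | rfl | hs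
    · refine continuousAt_id.congr ?_
      filter_upwards [Iio_mem_nhds hs] with t ht
      exact (hψneg t (le_of_lt ht)).symm
    · rw [ContinuousAt, hψneg 0 le_rfl]
      refine squeeze_zero_norm' (a := fun s => |s|) ?_ (by
        simpa using (continuous_abs.tendsto (0 : ℝ)))
      filter_upwards [Iio_mem_nhds one_pos] with t ht
      rcases le_or_gt t 0 with h | h
      · rw [hψneg t h, Real.norm_eq_abs]
      · rw [Real.norm_of_nonneg (by rw [hψpos t h]; positivity), abs_of_pos h]
        exact hsmall t h (le_of_lt ht)
    · refine ((hΦ s hs).continuousAt.rexp).congr ?_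
      filter_upwards [Ioi_mem_nhds hs] with t ht
      exact (hψpos t ht).symm
  have hsurj : Function.Surjective ψ := by
    refine hψcont.surjective ?_ ?_
    · exact tendsto_atTop_mono' _ ((eventually_ge_atTop 1).mono hlarge) tendsto_id
    · exact tendsto_id.congr' ((eventually_le_atBot 0).mono fun s hs => (hψneg s hs).symm)
  refine ⟨hmono.orderIsoOfSurjective ψ hsurj, hψneg 0 le_rfl, fun s hs => ⟨?_, ?_⟩⟩
  · change 0 < ψ s
    rw [hψpos s hs]
    exact Real.exp_pos _
  · refine (hΦ s hs).congr_of_eventuallyEq ?_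
    filter_upwards [Ioi_mem_nhds hs] with t ht
    change Real.log (ψ t) = Φ t
    rw [hψpos t ht, Real.log_exp]

/-- Comparison principle: decay at a positive definite rate is bounded by a `𝒦ℒ` function. -/
theorem exists_classKL_of_decay {ρ : ℝ → ℝ} (hρ : LipschitzWith 1 ρ) (hρ0 : ρ 0 = 0)
    (hρpos : ∀ r, 0 < r → 0 < ρ r) :
    ∃ β : ℝ → ℝ → ℝ, Continuous (Function.uncurry β) ∧ IsClassKL β ∧
      ∀ T, 0 ≤ T → ∀ y : ℝ → ℝ, ContinuousOn y (Icc 0 T) → (∀ s ∈ Icc 0 T, 0 < y s) →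
        (∀ a b, 0 ≤ a → a ≤ b → b ≤ T → y b - y a ≤ -∫ s in a..b, ρ (y s)) →
        y T ≤ β (y 0) T := by
  obtain ⟨ψ, ψ0, hψ⟩ := exists_orderIso_gauge hρ hρ0 hρpos
  have hψ_nonneg : ∀ r, 0 ≤ r → 0 ≤ ψ r := fun r hr => by
    rw [← ψ0]
    exact ψ.monotone hr
  have hsymm0 : ψ.symm 0 = 0 := by rw [OrderIso.symm_apply_eq, ψ0]
  have hβc : Continuous (Function.uncurry fun r t => ψ.symm (ψ r * Real.exp (-t))) := by
    have h1 := ψ.continuous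
    have h2 := ψ.symm.continuous
    exact h2.comp ((h1.comp continuous_fst).mul (Real.continuous_exp.comp continuous_snd.neg))
  -- If `y' = -ρ(y)`, then `log (ψ y)` has slope `-1`; this `β` is the resulting explicit solution.
  refine ⟨fun r t => ψ.symm (ψ r * Real.exp (-t)), hβc, ⟨hβc.continuousOn, fun t ht => ?_,
    fun r hr => ?_, fun r hr => ?_⟩, fun T hT y hyc hy hdec => ?_⟩
  · refine ⟨(hβc.comp (Continuous.prodMk_left t)).continuousOn, fun r _ s _ hrs => ?_, ?_⟩
    · exact ψ.symm.strictMono (mul_lt_mul_of_pos_right (ψ.strictMono hrs) (Real.exp_pos _))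
    · simp [ψ0, hsymm0]
  · intro s _ t _ hst
    refine ψ.symm.monotone (mul_le_mul_of_nonneg_left ?_ (hψ_nonneg r hr))
    exact Real.exp_le_exp.2 (neg_le_neg hst)
  · have h1 : Tendsto (fun t => ψ r * Real.exp (-t)) atTop (𝓝 0) := by
      simpa using Real.tendsto_exp_neg_atTop_nhds_zero.const_mul (ψ r)
    have h2 := (ψ.symm.continuous.tendsto 0).comp h1
    rwa [hsymm0] at h2
  · obtain ⟨z, hzc, hz⟩ : ∃ z : ℝ → ℝ, Continuous z ∧ ∀ s ∈ Icc 0 T, z s = y s :=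
      ⟨IccExtend hT ((Icc 0 T).domRestrict y), (continuousOn_iff_continuous_domRestrict.1 hyc).Icc_extend',
        fun s hs => IccExtend_of_mem hT _ hs⟩
    have hmain : ∀ ⦃s⦄, s ∈ Icc 0 T → Real.log (ψ (z s)) ≤ Real.log (ψ (z 0)) - s := by
      refine image_le_of_liminf_slope_right_le_deriv_boundary (B' := fun _ => -1) ?_ (by simp)
        (by fun_prop) (fun x _ => ?_) fun x hx r hr => ?_
      · exact (ψ.continuous.comp hzc).continuousOn.log fun s hs => by
          rw [Function.comp_apply, hz s hs]
          exact (hψ _ (hy s hs)).1.ne'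
      · exact ((hasDerivAt_id x).const_sub _).hasDerivWithinAt
      · have hxI : x ∈ Icc 0 T := Ico_subset_Icc_self hx
        have hzx : 0 < z x := by
          rw [hz x hxI]
          exact hy x hxI
        -- `z` need not be differentiable. The differentiable `w` agrees with it at `x` and lies
        -- above it just to the right, so it bounds the right slopes of `log (ψ z)`.
        let w : ℝ → ℝ := fun s => z x - ∫ u in x..s, ρ (z u)
        have hw : HasDerivAt w (-ρ (z x)) x :=
          ((hρ.continuous.comp hzc).integral_hasStrictDerivAt x x).hasDerivAt.const_sub _
        have hwx : w x = z x := by simp [w]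
        have hR : HasDerivAt (fun s => Real.log (ψ (w s))) (-1) x := by
          have h1 := (hψ (z x) hzx).2
          rw [← hwx] at h1
          have h2 := h1.comp x hw
          rw [hwx, mul_neg, one_div_mul_cancel (hρpos _ hzx).ne'] at h2
          exact h2
        have hslope := (hasDerivAt_iff_tendsto_slope.1 hR).mono_left
          (nhdsWithin_mono x (fun s (hs : x < s) => hs.ne' : Ioi x ⊆ {x}ᶜ))
        have hev : ∀ᶠ s in 𝓝[>] x, slope (fun s => Real.log (ψ (z s))) x s < r := by
          filter_upwards [hslope.eventually (eventually_lt_nhds hr), Ioo_mem_nhdsGT hx.2]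
            with s hs1 hs2
          refine lt_of_le_of_lt ?_ hs1
          have hsI : s ∈ Icc 0 T := ⟨hx.1.trans hs2.1.le, hs2.2.le⟩
          have hzs : 0 < z s := by
            rw [hz s hsI]
            exact hy s hsI
          have hle : z s ≤ w s := by
            have h1 := hdec x s hx.1 hs2.1.le hs2.2.le
            have h2 : ∫ u in x..s, ρ (y u) = ∫ u in x..s, ρ (z u) := by
              refine intervalIntegral.integral_congr fun u hu => ?_
              rw [uIcc_of_le hs2.1.le] at hu
              simp only [hz u ⟨hx.1.trans hu.1, hu.2.trans hs2.2.le⟩]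
            rw [h2, ← hz s hsI, ← hz x hxI] at h1
            simp only [w]
            linarith
          rw [slope_def_field, slope_def_field, hwx]
          have : 0 < s - x := sub_pos.2 hs2.1
          have := Real.log_le_log (hψ _ hzs).1 (ψ.monotone hle)
          gcongr
        exact hev.frequently
    have hT' : T ∈ Icc 0 T := ⟨hT, le_rfl⟩
    have h0' : (0 : ℝ) ∈ Icc 0 T := ⟨le_rfl, hT⟩
    have h := hmain hT'
    rw [hz T hT', hz 0 h0'] at h
    rw [OrderIso.le_symm_apply]
    have hp0 := (hψ _ (hy 0 h0')).1
    have hpT := (hψ _ (hy T hT')).1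
    rw [← Real.log_le_log_iff hpT (by positivity), Real.log_mul hp0.ne' (Real.exp_pos _).ne',
      Real.log_exp]
    linarith

/-! ### Carathéodory solutions by Picard iteration -/

/-- Carathéodory existence theorem: an equation whose right hand side is measurable in time and,
locally uniformly in time, bounded and Lipschitz in the state has a solution on `[0, ∞)`. -/
theorem exists_caratheodory_solution {E : Type*} [NormedAddCommGroup E] [NormedSpace ℝ E]
    [CompleteSpace E] (H : ℝ → E → E)
    (hmeas : ∀ y : ℝ → E, Continuous y → AEStronglyMeasurable (fun s => H s (y s)) volume)
    (hH : ∀ T : ℝ, ∃ Λ : ℝ, 0 ≤ Λ ∧ ∀ᵐ s : ℝ, |s| ≤ T →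
      (∀ x, ‖H s x‖ ≤ Λ) ∧ ∀ x y, ‖H s x - H s y‖ ≤ Λ * ‖x - y‖) (x₀ : E) :
    ∃ x : ℝ → E, Continuous x ∧ (∀ a b, IntervalIntegrable (fun s => H s (x s)) volume a b) ∧
      ∀ t, 0 ≤ t → x t = x₀ + ∫ s in (0 : ℝ)..t, H s (x s) := by
  have hint : ∀ y : ℝ → E, Continuous y → ∀ a b,
      IntervalIntegrable (fun s => H s (y s)) volume a b := by
    intro y hy a b
    obtain ⟨Λ, -, hΛ⟩ := hH (max |a| |b|)
    refine (intervalIntegrable_const (c := Λ)).mono_fun (hmeas y hy).restrict ?_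
    rw [EventuallyLE, ae_restrict_iff' measurableSet_uIoc]
    filter_upwards [hΛ] with s hs hsab
    exact ((hs (abs_le_max_abs_abs hsab.1.le hsab.2 |>.trans (by
      rcases le_total a b with h | h <;> simp [h, max_comm]))).1 _).trans (le_abs_self Λ)
  -- Truncation at `max t 0` freezes the iterates at `x₀` in negative time, so all estimates concern
  -- forward time only.
  let Pic : (ℝ → E) → ℝ → E := fun y t => x₀ + ∫ s in (0 : ℝ)..max t 0, H s (y s)
  have hPic : ∀ y, Continuous y → Continuous (Pic y) := fun y hy =>
    continuous_const.add ((intervalIntegral.continuous_primitive (hint y hy) 0).comp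
      (continuous_id.max continuous_const))
  let X : ℕ → ℝ → E := fun k => Pic^[k] fun _ => x₀
  have hXs : ∀ k, X (k + 1) = Pic (X k) := fun k => Function.iterate_succ_apply' _ _ _
  have hXc : ∀ k, Continuous (X k) := fun k => by
    induction k with
    | zero => exact continuous_const
    | succ k ih =>
      rw [hXs]
      exact hPic _ ih
  have hstep : ∀ T Λ : ℝ, 0 ≤ Λ → (∀ᵐ s : ℝ, |s| ≤ T →
      (∀ x, ‖H s x‖ ≤ Λ) ∧ ∀ x y, ‖H s x - H s y‖ ≤ Λ * ‖x - y‖) → 0 ≤ T → ∀ k, ∀ t ≤ T,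
      ‖X (k + 1) t - X k t‖ ≤ Λ ^ (k + 1) * max t 0 ^ (k + 1) / (k + 1).factorial := by
    intro T Λ hΛ0 hΛ hT k
    have habs : ∀ t ≤ T, ∀ s ∈ Ioc 0 (max t 0), |s| ≤ T := fun t ht s hs => by
      rw [abs_of_pos hs.1]
      exact hs.2.trans (max_le ht hT)
    induction k with
    | zero =>
      intro t ht
      have h1 : X 1 t - X 0 t = ∫ s in (0 : ℝ)..max t 0, H s (X 0 s) := by
        rw [hXs 0]
        simp [Pic, X]
      rw [h1]
      have h2 : ‖∫ s in (0 : ℝ)..max t 0, H s (X 0 s)‖ ≤ ∫ s in (0 : ℝ)..max t 0, Λ := by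
        refine intervalIntegral.norm_integral_le_of_norm_le (le_max_right _ _) ?_
          intervalIntegrable_const
        filter_upwards [hΛ] with s hs hs'
        exact (hs (habs t ht s hs')).1 _
      refine h2.trans_eq ?_
      rw [intervalIntegral.integral_const]
      simp [mul_comm]
    | succ k ih =>
      intro t ht
      have h1 : X (k + 1 + 1) t - X (k + 1) t =
          ∫ s in (0 : ℝ)..max t 0, (H s (X (k + 1) s) - H s (X k s)) := by
        rw [hXs (k + 1), intervalIntegral.integral_sub (hint _ (hXc _) _ _) (hint _ (hXc _) _ _)]
        conv_lhs => rw [hXs k]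
        simp only [Pic, ← hXs k]
        abel
      rw [h1]
      have h2 : ‖∫ s in (0 : ℝ)..max t 0, (H s (X (k + 1) s) - H s (X k s))‖ ≤
          ∫ s in (0 : ℝ)..max t 0, Λ * (Λ ^ (k + 1) / (k + 1).factorial) * s ^ (k + 1) := by
        refine intervalIntegral.norm_integral_le_of_norm_le (le_max_right _ _) ?_
          (Continuous.intervalIntegrable (by fun_prop) _ _)
        filter_upwards [hΛ] with s hs hs'
        have hsT := habs t ht s hs'
        refine ((hs hsT).2 _ _).trans ?_
        rw [mul_assoc]
        refine mul_le_mul_of_nonneg_left ((ih s ((le_abs_self s).trans hsT)).trans_eq ?_) hΛ0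
        rw [max_eq_left hs'.1.le]
        ring
      refine h2.trans_eq ?_
      rw [intervalIntegral.integral_const_mul, integral_pow, Nat.factorial_succ (k + 1)]
      push_cast
      field_simp
      ring
  have hsummable : ∀ c : ℝ, Summable fun k : ℕ => c ^ (k + 1) / (k + 1).factorial := fun c =>
    (summable_nat_add_iff 1).2 (Real.summable_pow_div_factorial c)
  -- The telescoping series of Picard steps converges uniformly on every `(-∞, T]` by the factorial
  -- bounds, whatever the size of `Λ T`.
  let x : ℝ → E := fun t => x₀ + ∑' k, (X (k + 1) t - X k t)
  have hunif : ∀ T, 0 ≤ T → TendstoUniformlyOn (fun N t => X N t) x atTop (Iic T) := by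
    intro T hT
    obtain ⟨Λ, hΛ0, hΛ⟩ := hH T
    have h := tendstoUniformlyOn_tsum_nat (hsummable (Λ * T)) (s := Iic T)
      (f := fun k t => X (k + 1) t - X k t) fun k t ht => by
        refine (hstep T Λ hΛ0 hΛ hT k t ht).trans ?_
        rw [mul_pow]
        gcongr
        exact max_le ht hT
    refine (Metric.tendstoUniformlyOn_iff.2 fun ε hε => ?_)
    filter_upwards [Metric.tendstoUniformlyOn_iff.1 h ε hε] with N hN t ht
    have := hN t ht
    rw [Finset.sum_range_sub (fun k => X k t)] at this
    rw [dist_eq_norm] at this ⊢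
    convert this using 2
    simp only [x, X, Function.iterate_zero, id]
    abel
  have hxc : Continuous x := by
    refine continuous_iff_continuousAt.2 fun t => ?_
    have := (hunif (|t| + 1) (by positivity)).continuousOn
      (Frequently.of_forall fun N => (hXc N).continuousOn)
    exact this.continuousAt (Iic_mem_nhds (by linarith [le_abs_self t]))
  refine ⟨x, hxc, hint x hxc, fun t ht => ?_⟩
  obtain ⟨Λ, hΛ0, hΛ⟩ := hH t
  have hlim : ∀ s ≤ t, Tendsto (fun N => X N s) atTop (𝓝 (x s)) := fun s hs =>
    (hunif t ht).tendsto_at hs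
  have h1 : Tendsto (fun N => X (N + 1) t) atTop (𝓝 (x t)) :=
    (hlim t le_rfl).comp (tendsto_add_atTop_nat 1)
  have h2 : Tendsto (fun N => x₀ + ∫ s in (0 : ℝ)..t, H s (X N s)) atTop
      (𝓝 (x₀ + ∫ s in (0 : ℝ)..t, H s (x s))) := by
    refine tendsto_const_nhds.add ?_
    refine intervalIntegral.tendsto_integral_filter_of_dominated_convergence (fun _ => Λ)
      (Eventually.of_forall fun N => (hmeas _ (hXc N)).restrict) (Eventually.of_forall fun N => ?_)
      intervalIntegrable_const ?_
    · filter_upwards [hΛ] with s hs hs'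
      rw [uIoc_of_le ht] at hs'
      exact (hs (by rw [abs_of_pos hs'.1]; exact hs'.2)).1 _
    · filter_upwards [hΛ] with s hs hs'
      rw [uIoc_of_le ht] at hs'
      have hl := (hs (by rw [abs_of_pos hs'.1]; exact hs'.2)).2
      rw [tendsto_iff_norm_sub_tendsto_zero]
      refine squeeze_zero (fun _ => norm_nonneg _) (fun N => hl (X N s) (x s)) ?_
      simpa using (tendsto_iff_norm_sub_tendsto_zero.1 (hlim s hs'.2)).const_mul Λ
  refine tendsto_nhds_unique h1 (h2.congr fun N => ?_)
  rw [hXs N]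
  simp only [Pic, max_eq_left ht]

/-! ### The iISS estimate along trajectories -/

theorem IsDisturbance.intervalIntegrable_norm {m : ℕ} {d : ℝ → Euc m} (hd : IsDisturbance d)
    {a b : ℝ} (ha : 0 ≤ a) (hb : 0 ≤ b) : IntervalIntegrable (fun s => ‖d s‖) volume a b := by
  have hsub : uIoc a b ⊆ Icc 0 (max a b) := fun s hs =>
    ⟨(le_min ha hb).trans hs.1.le, hs.2⟩
  obtain ⟨M, hM⟩ := hd.locallyBounded (max a b) (ha.trans (le_max_left _ _))
  refine (intervalIntegrable_const (c := M)).mono_fun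
    (hd.measurable.norm.mono_measure
      (Measure.restrict_mono (hsub.trans Icc_subset_Ici_self) le_rfl)) ?_
  have := ae_mono (Measure.restrict_mono hsub le_rfl) hM
  filter_upwards [this] with s hs
  rw [norm_norm]
  exact hs.trans (le_abs_self M)

theorem inputMap_add {n m : ℕ} (g : Fin m → Euc n → Euc n) (x : Euc n) (u v : Euc m) :
    inputMap g x (u + v) = inputMap g x u + inputMap g x v := by
  simp [inputMap, add_smul, Finset.sum_add_distrib]

theorem continuous_inputMap {n m : ℕ} {g : Fin m → Euc n → Euc n} (hg : ∀ i, Continuous (g i)) :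
    Continuous fun p : Euc n × Euc m => inputMap g p.1 p.2 := by
  unfold inputMap
  refine continuous_finsetSum _ fun i _ => ?_
  have h : Continuous fun p : Euc n × Euc m => p.2 i := by fun_prop
  exact h.smul ((hg i).comp continuous_fst)

/-- The integral-input-to-state estimate along trajectories, from a dissipation inequality. -/
theorem exists_iISS_estimate {n m : ℕ} {F : Euc n → Euc m → Euc n} {W : Euc n → ℝ}
    (hW : ContDiff ℝ 1 W) (hWpos : PosDefFun W) (hWu : RadiallyUnbounded W) {α : ℝ → ℝ} {c : ℝ}
    (hα : ContinuousOn α (Ici 0)) (hα0 : α 0 = 0) (hαpos : ∀ r, 0 < r → 0 < α r) (hc : 0 ≤ c)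
    (hdec : ∀ x d, fderiv ℝ W x (F x d) ≤ -α ‖x‖ + c * ‖d‖) :
    ∃ (β : ℝ → ℝ → ℝ) (α γ : ℝ → ℝ), IsClassKL β ∧ IsClassKInf α ∧ IsClassKInf γ ∧
      ∀ d : ℝ → Euc m, IsDisturbance d → ∀ T, 0 ≤ T → ∀ x : ℝ → Euc n, IsTrajectoryOn F d T x →
        ∀ t ∈ Icc 0 T, α ‖x t‖ ≤ β ‖x 0‖ t + ∫ s in (0 : ℝ)..t, γ ‖d s‖ := by
  have hαc : Continuous fun x : Euc n => α ‖x‖ :=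
    hα.comp_continuous continuous_norm fun x => norm_nonneg x
  have hαx : PosDefFun fun x : Euc n => α ‖x‖ :=
    ⟨by simp [hα0], fun x hx => hαpos _ (norm_pos_iff.2 hx)⟩
  obtain ⟨ρ, hρ, hρ0, hρpos, hρle⟩ := exists_lipschitz_posDef_minorant hαc hαx hW.continuous hWpos
    hWu
  obtain ⟨αl, hαl, hαlW⟩ := exists_classKInf_le hW.continuous hWpos hWu
  obtain ⟨αu, hαuc, hαu, hαuW⟩ := exists_classK_ge hW.continuous hWpos.1
  obtain ⟨β, hβc, hβ, hβdec⟩ := exists_classKL_of_decay hρ hρ0 hρpos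
  have hαu_nonneg : ∀ r, 0 ≤ r → 0 ≤ αu r := fun r hr => by
    rw [← hαu.map_zero]
    exact hαu.strictMonoOn.monotoneOn self_mem_Ici hr hr
  have hβ0 : ∀ r t, 0 ≤ r → 0 ≤ t → 0 ≤ β r t := fun r t hr ht => by
    rw [← (hβ.classK t ht).map_zero]
    exact (hβ.classK t ht).strictMonoOn.monotoneOn self_mem_Ici hr hr
  -- The estimate needs the gain `2 * c`; the extra 1 keeps it of class `𝒦_∞` when `c = 0`.
  refine ⟨fun r t => β (αu r) t, αl, fun r => (2 * c + 1) * r, ?_, hαl, ?_, ?_⟩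
  · refine ⟨(hβc.comp ((hαuc.comp continuous_fst).prodMk continuous_snd)).continuousOn,
      fun t ht => ⟨?_, fun r hr s hs hrs => ?_, ?_⟩, fun r hr => hβ.antitoneOn _ (hαu_nonneg r hr),
      fun r hr => hβ.tendsto _ (hαu_nonneg r hr)⟩
    · exact (hβc.comp (hαuc.prodMk continuous_const)).continuousOn
    · exact (hβ.classK t ht).strictMonoOn (hαu_nonneg r hr) (hαu_nonneg s hs)
        (hαu.strictMonoOn hr hs hrs)
    · simp only [hαu.map_zero, (hβ.classK t ht).map_zero]
  · exact ⟨⟨by fun_prop, fun r _ s _ hrs => mul_lt_mul_of_pos_left hrs (by positivity), by simp⟩,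
      tendsto_id.const_mul_atTop (by positivity)⟩
  · intro d hd T hT x hx t ht
    have hdint : ∀ a b, 0 ≤ a → 0 ≤ b → IntervalIntegrable (fun s => c * ‖d s‖) volume a b :=
      fun a b ha hb => (hd.intervalIntegrable_norm ha hb).const_mul c
    have hαint : ∀ a b, 0 ≤ a → a ≤ b → b ≤ t →
        IntervalIntegrable (fun s => α ‖x s‖) volume a b := fun a b ha hab hb => by
      refine ContinuousOn.intervalIntegrable ?_
      rw [uIcc_of_le hab]
      exact hαc.comp_continuousOn (hx.continuousOn.mono (Icc_subset_Icc ha (hb.trans ht.2)))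
    let v : ℝ → ℝ := fun s => ∫ τ in (0 : ℝ)..s, c * ‖d τ‖
    have hvdiff : ∀ a b, 0 ≤ a → 0 ≤ b → v b - v a = ∫ τ in a..b, c * ‖d τ‖ := fun a b ha hb =>
      intervalIntegral.integral_interval_sub_left (hdint 0 b le_rfl hb) (hdint 0 a le_rfl ha)
    have hvmono : ∀ a b, 0 ≤ a → a ≤ b → v a ≤ v b := fun a b ha hab => by
      rw [← sub_nonneg, hvdiff a b ha (ha.trans hab)]
      exact intervalIntegral.integral_nonneg hab fun s _ => by positivity
    have hv0 : v 0 = 0 := intervalIntegral.integral_same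
    have hvc : ContinuousOn v (Icc 0 t) := by
      have := intervalIntegral.continuousOn_primitive_interval'
        (hdint 0 t le_rfl ht.1) left_mem_uIcc
      rwa [uIcc_of_le ht.1] at this
    let y : ℝ → ℝ := fun s => W (x s) - v s
    have hydec : ∀ a b, 0 ≤ a → a ≤ b → b ≤ t → y b - y a ≤ -∫ s in a..b, α ‖x s‖ := by
      intro a b ha hab hb
      obtain ⟨h1, h2⟩ := integral_fderiv_comp_eq_sub hW hx.continuousOn hx.integrable hx.eq_integral
        ha hab (hb.trans ht.2)
      have h4 : IntervalIntegrable (fun s => -α ‖x s‖) volume a b := (hαint a b ha hab hb).neg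
      have h3 : W (x b) - W (x a) ≤ ∫ s in a..b, (-α ‖x s‖ + c * ‖d s‖) := by
        rw [← h2]
        exact intervalIntegral.integral_mono_on hab h1
          (h4.add (hdint a b ha (ha.trans hab))) fun s _ => hdec _ _
      rw [intervalIntegral.integral_add h4 (hdint a b ha (ha.trans hab)),
        intervalIntegral.integral_neg, ← hvdiff a b ha (ha.trans hab)] at h3
      simp only [y]
      linarith
    have hγ : 2 * v t ≤ ∫ s in (0 : ℝ)..t, (2 * c + 1) * ‖d s‖ := by
      simp only [v]
      rw [← intervalIntegral.integral_const_mul]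
      refine intervalIntegral.integral_mono_on ht.1 ((hdint 0 t le_rfl ht.1).const_mul 2)
        ((hd.intervalIntegrable_norm le_rfl ht.1).const_mul _) fun s _ => ?_
      linarith [norm_nonneg (d s)]
    have hWβ : W (x t) ≤ β (αu ‖x 0‖) t + 2 * v t := by
      -- In the first case `W ≤ 2v` at time `t`. In the second, `y` decreases and `v` increases, so
      -- `v < y` held on all of `[0, t]`; hence `W / 2 ≤ y ≤ W` there and the decay rate is at least
      -- `ρ y`.
      rcases le_or_gt (y t) (v t) with h | h
      · have := hβ0 _ t (hαu_nonneg _ (norm_nonneg (x 0))) ht.1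
        simp only [y] at h
        linarith
      · have hys : ∀ s ∈ Icc 0 t, v s < y s := fun s hs => by
          have h1 := hydec s t hs.1 hs.2 le_rfl
          have h2 : 0 ≤ ∫ τ in s..t, α ‖x τ‖ :=
            intervalIntegral.integral_nonneg hs.2 fun τ _ => hαx.nonneg (x τ)
          linarith [hvmono s t hs.1 hs.2]
        have hvs : ∀ s ∈ Icc 0 t, 0 ≤ v s := fun s hs => hv0 ▸ hvmono 0 s le_rfl hs.1
        have hyc : ContinuousOn y (Icc 0 t) :=
          (hW.continuous.comp_continuousOn
            (hx.continuousOn.mono (Icc_subset_Icc_right ht.2))).sub hvc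
        have h1 := hβdec t ht.1 y hyc (fun s hs => (hvs s hs).trans_lt (hys s hs))
          fun a b ha hab hb => (hydec a b ha hab hb).trans (by
            refine neg_le_neg (intervalIntegral.integral_mono_on hab ?_ (hαint a b ha hab hb)
              fun s hs => ?_)
            · refine ContinuousOn.intervalIntegrable ?_
              rw [uIcc_of_le hab]
              exact hρ.continuous.comp_continuousOn (hyc.mono (Icc_subset_Icc ha hb))
            · have hs' : s ∈ Icc 0 t := ⟨ha.trans hs.1, hs.2.trans hb⟩
              have h1 := hys s hs'
              have h2 := hvs s hs'
              simp only [y] at h1 ⊢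
              exact hρle (x s) _ (by linarith) (by linarith))
        have h2 : y 0 ≤ αu ‖x 0‖ := by
          simp only [y, hv0, sub_zero]
          exact hαuW _
        have h3 := (hβ.classK t ht.1).strictMonoOn.monotoneOn
          (((hvs 0 ⟨le_rfl, ht.1⟩).trans (hys 0 ⟨le_rfl, ht.1⟩).le)) (hαu_nonneg _ (norm_nonneg _)) h2
        have h4 : W (x t) = y t + v t := by simp [y]
        have h5 := hvs t ⟨ht.1, le_rfl⟩
        linarith
    exact (hαlW (x t)).trans (hWβ.trans (by linarith))

/-! ### Cutoffs and global solutions -/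

theorem exists_bound_lipschitz_of_hasCompactSupport {n : ℕ} {f : Euc n → Euc n}
    (hf : ContDiff ℝ 1 f) (hs : HasCompactSupport f) :
    ∃ K : ℝ, 0 ≤ K ∧ (∀ x, ‖f x‖ ≤ K) ∧ ∀ x y, ‖f x - f y‖ ≤ K * ‖x - y‖ := by
  obtain ⟨M, hM⟩ := hf.continuous.norm.bddAbove_range_of_hasCompactSupport (hs.comp_left norm_zero)
  obtain ⟨L, hL⟩ := hf.lipschitzWith_of_hasCompactSupport hs (by simp)
  refine ⟨max M L, L.2.trans (le_max_right _ _), fun x =>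
    (hM (mem_range_self x)).trans (le_max_left _ _), fun x y => ?_⟩
  rw [← dist_eq_norm, ← dist_eq_norm]
  exact (hL.dist_le_mul x y).trans (mul_le_mul_of_nonneg_right (le_max_right _ _) dist_nonneg)

/-- Since the field is affine in `d`, both constants grow only linearly in `‖d‖`; an essentially
bounded disturbance therefore gives uniform constants. -/
theorem exists_bound_lipschitz_cutoff {n m : ℕ} {F₀ : Euc n → Euc n} {g : Fin m → Euc n → Euc n}
    (hF₀ : ContDiff ℝ 1 F₀) (hg : ∀ i, ContDiff ℝ 1 (g i)) {χ : Euc n → ℝ} (hχ : ContDiff ℝ 1 χ)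
    (hs : HasCompactSupport χ) :
    ∃ K : ℝ, 0 ≤ K ∧ ∀ d : Euc m,
      (∀ x, ‖χ x • (F₀ x + inputMap g x d)‖ ≤ K * (1 + ‖d‖)) ∧
      ∀ x y, ‖χ x • (F₀ x + inputMap g x d) - χ y • (F₀ y + inputMap g y d)‖ ≤
        K * (1 + ‖d‖) * ‖x - y‖ := by
  obtain ⟨K₀, hK₀, hb₀, hl₀⟩ :=
    exists_bound_lipschitz_of_hasCompactSupport (hχ.smul hF₀) hs.smul_right
  choose K hK hb hl using fun i =>
    exists_bound_lipschitz_of_hasCompactSupport (hχ.smul (hg i)) hs.smul_right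
  have hexp : ∀ x (d : Euc m), χ x • (F₀ x + inputMap g x d) =
      χ x • F₀ x + ∑ i, d i • (χ x • g i x) := fun x d => by
    simp only [inputMap, smul_add, Finset.smul_sum, smul_comm (χ x)]
  have hKsum : 0 ≤ ∑ i, K i := Finset.sum_nonneg fun i _ => hK i
  have hsum : ∀ d : Euc m, K₀ + ∑ i, ‖d i‖ * K i ≤ (K₀ + ∑ i, K i) * (1 + ‖d‖) := fun d => by
    have : ∑ i, ‖d i‖ * K i ≤ ‖d‖ * ∑ i, K i := by
      rw [Finset.mul_sum]
      exact Finset.sum_le_sum fun i _ =>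
        mul_le_mul_of_nonneg_right (PiLp.norm_apply_le d i) (hK i)
    nlinarith [norm_nonneg d]
  refine ⟨K₀ + ∑ i, K i, by positivity, fun d => ⟨fun x => ?_, fun x y => ?_⟩⟩
  · rw [hexp]
    refine (norm_add_le_of_le (hb₀ x) (norm_sum_le_of_le _ fun i _ => ?_)).trans (hsum d)
    rw [norm_smul]
    exact mul_le_mul_of_nonneg_left (hb i x) (norm_nonneg _)
  · rw [hexp, hexp, add_sub_add_comm, ← Finset.sum_sub_distrib]
    refine (norm_add_le_of_le (hl₀ x y) (norm_sum_le_of_le _ fun i _ =>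
      (?_ : _ ≤ ‖d i‖ * K i * ‖x - y‖))).trans ?_
    · rw [← smul_sub, norm_smul, mul_assoc]
      exact mul_le_mul_of_nonneg_left (hl i x y) (norm_nonneg _)
    · rw [← Finset.sum_mul, ← add_mul]
      exact mul_le_mul_of_nonneg_right (hsum d) (norm_nonneg _)

/-- A proper function that grows along the system at most at a rate proportional to the size of
the disturbance gives global solutions. -/
theorem exists_global_trajectory {n m : ℕ} {F₀ : Euc n → Euc n} {g : Fin m → Euc n → Euc n}
    (hF₀ : ContDiff ℝ 1 F₀) (hg : ∀ i, ContDiff ℝ 1 (g i)) {W : Euc n → ℝ}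
    (hW : ContDiff ℝ 1 W) (hWu : RadiallyUnbounded W) {c : ℝ} (hc : 0 ≤ c)
    (hdec : ∀ x d, fderiv ℝ W x (F₀ x + inputMap g x d) ≤ c * ‖d‖) {d : ℝ → Euc m}
    (hd : IsDisturbance d) (x₀ : Euc n) :
    ∃ x : ℝ → Euc n, x 0 = x₀ ∧
      ∀ T, 0 ≤ T → IsTrajectoryOn (fun x d => F₀ x + inputMap g x d) d T x := by
  let F : Euc n → Euc m → Euc n := fun x d => F₀ x + inputMap g x d
  have hFc : Continuous fun p : Euc n × Euc m => F p.1 p.2 :=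
    (hF₀.continuous.comp continuous_fst).add (continuous_inputMap fun i => (hg i).continuous)
  -- `M N` is the a priori bound for `W` on `[0, N]`, and `R N` the radius of a ball containing the
  -- corresponding sublevel set.
  let M : ℕ → ℝ := fun N => W x₀ + ∫ s in (0 : ℝ)..N, c * ‖d s‖
  have hR : ∀ N, ∃ R : ℝ, 0 < R ∧ ∀ x, W x ≤ M N → ‖x‖ ≤ R := fun N => by
    obtain ⟨R, hR⟩ := radiallyUnbounded_iff.1 hWu (M N + 1)
    refine ⟨max R 1, by positivity, fun x hx => ?_⟩
    by_contra h
    have := hR x ((le_max_left _ _).trans (not_le.1 h).le)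
    linarith
  choose R R_pos hR using hR
  let χ : ∀ N : ℕ, ContDiffBump (0 : Euc n) := fun N => ⟨R N, R N + 1, R_pos N, by linarith⟩
  let dt : ℝ → Euc m := (Ici 0).indicator d
  have hdt : ∀ s, 0 ≤ s → dt s = d s := fun s hs => indicator_of_mem hs d
  have hdtm : AEStronglyMeasurable dt volume :=
    (aestronglyMeasurable_indicator_iff measurableSet_Ici).2 hd.measurable
  -- The cutoff changes at integer times: on `[N, N + 1)` it uses the radius valid up to `N + 1`.
  -- One equation thus serves all times, with constants uniform on bounded intervals.
  let H : ℝ → Euc n → Euc n := fun s x => χ (⌊s⌋₊ + 1) x • F x (dt s)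
  have hmeas : ∀ y : ℝ → Euc n, Continuous y →
      AEStronglyMeasurable (fun s => H s (y s)) volume := by
    intro y hy
    have hU : (⋃ N : ℕ, {s : ℝ | ⌊s⌋₊ = N}) = univ := by
      ext s
      simp
    rw [← Measure.restrict_univ (μ := volume), ← hU]
    refine AEStronglyMeasurable.iUnion fun N => ?_
    have h1 : AEStronglyMeasurable (fun s => χ (N + 1) (y s) • F (y s) (dt s)) volume :=
      ((χ (N + 1)).continuous.comp hy).aestronglyMeasurable.smul
        (hFc.comp_aestronglyMeasurable (hy.aestronglyMeasurable.prodMk hdtm))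
    refine h1.restrict.congr ?_
    refine (ae_restrict_iff' (Nat.measurable_floor (measurableSet_singleton N))).2
      (Eventually.of_forall fun s hs => ?_)
    have hs' : ⌊s⌋₊ = N := hs
    simp only [H, hs']
  have hH : ∀ T : ℝ, ∃ Λ : ℝ, 0 ≤ Λ ∧ ∀ᵐ s : ℝ, |s| ≤ T →
      (∀ x, ‖H s x‖ ≤ Λ) ∧ ∀ x y, ‖H s x - H s y‖ ≤ Λ * ‖x - y‖ := by
    intro T
    choose K hK hKb using fun N => exists_bound_lipschitz_cutoff hF₀ hg
      (χ N).contDiff (χ N).hasCompactSupport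
    obtain ⟨B, hB⟩ := hd.locallyBounded (max T 0) (le_max_right _ _)
    rw [ae_restrict_iff' measurableSet_Icc] at hB
    have hB' : ∀ᵐ s : ℝ, |s| ≤ T → ‖dt s‖ ≤ |B| := by
      filter_upwards [hB] with s hs hsT
      rcases lt_or_ge s 0 with h | h
      · simp [dt, indicator_of_notMem (show s ∉ Ici 0 from not_le.2 h)]
      · rw [hdt s h]
        exact (hs ⟨h, (le_abs_self s).trans (hsT.trans (le_max_left _ _))⟩).trans (le_abs_self B)
    have hKs : ∀ s : ℝ, |s| ≤ T → K (⌊s⌋₊ + 1) ≤ ∑ N ∈ Finset.range (⌊T⌋₊ + 2), K N :=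
      fun s hs => Finset.single_le_sum (fun N _ => hK N) (by
        have := Nat.floor_mono ((le_abs_self s).trans hs)
        simp
        lia)
    have hsum0 : 0 ≤ ∑ N ∈ Finset.range (⌊T⌋₊ + 2), K N := Finset.sum_nonneg fun N _ => hK N
    refine ⟨(∑ N ∈ Finset.range (⌊T⌋₊ + 2), K N) * (1 + |B|), by positivity, ?_⟩
    filter_upwards [hB'] with s hs hsT
    have hle : K (⌊s⌋₊ + 1) * (1 + ‖dt s‖) ≤
        (∑ N ∈ Finset.range (⌊T⌋₊ + 2), K N) * (1 + |B|) :=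
      mul_le_mul (hKs s hsT) (by linarith [hs hsT]) (by positivity) hsum0
    exact ⟨fun x => ((hKb _ (dt s)).1 x).trans hle, fun x y =>
      ((hKb _ (dt s)).2 x y).trans (mul_le_mul_of_nonneg_right hle (norm_nonneg _))⟩
  obtain ⟨x, hxc, hxint, hx⟩ := exists_caratheodory_solution H hmeas hH x₀
  have hx0 : x 0 = x₀ := by simpa using hx 0 le_rfl
  have hdint : ∀ a b, 0 ≤ a → 0 ≤ b → IntervalIntegrable (fun s => c * ‖d s‖) volume a b :=
    fun a b ha hb => (hd.intervalIntegrable_norm ha hb).const_mul c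
  -- As `0 ≤ χ ≤ 1`, the growth bound survives the cutoff. The solution thus stays where `χ = 1` and
  -- solves the original equation.
  have hWx : ∀ t, 0 ≤ t → W (x t) ≤ W x₀ + ∫ s in (0 : ℝ)..t, c * ‖d s‖ := by
    intro t ht
    obtain ⟨h1, h2⟩ := integral_fderiv_comp_eq_sub hW hxc.continuousOn (hxint 0 t)
      (fun s hs => by rw [hx0]; exact hx s hs.1) le_rfl ht le_rfl
    have h3 : W (x t) - W (x 0) ≤ ∫ s in (0 : ℝ)..t, c * ‖d s‖ := by
      rw [← h2]
      refine intervalIntegral.integral_mono_on ht h1 (hdint 0 t le_rfl ht) fun s hs => ?_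
      simp only [H, map_smul, smul_eq_mul, hdt s hs.1]
      have h4 := hdec (x s) (d s)
      have h5 : 0 ≤ c * ‖d s‖ := by positivity
      have h6 := (χ (⌊s⌋₊ + 1)).nonneg (x := x s)
      have h7 := (χ (⌊s⌋₊ + 1)).le_one (x := x s)
      exact (mul_le_mul_of_nonneg_left h4 h6).trans (mul_le_of_le_one_left h5 h7)
    rw [hx0] at h3
    linarith
  have hHF : ∀ s, 0 ≤ s → H s (x s) = F (x s) (d s) := by
    intro s hs
    have hsN : s ≤ ((⌊s⌋₊ + 1 : ℕ) : ℝ) := by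
      push_cast
      exact (Nat.lt_floor_add_one s).le
    have h1 : W (x s) ≤ M (⌊s⌋₊ + 1) := by
      refine (hWx s hs).trans (add_le_add_right ?_ _)
      have h2 := intervalIntegral.integral_interval_sub_left
        (hdint 0 _ le_rfl (hs.trans hsN)) (hdint 0 s le_rfl hs)
      have h3 : 0 ≤ ∫ τ in s..((⌊s⌋₊ + 1 : ℕ) : ℝ), c * ‖d τ‖ :=
        intervalIntegral.integral_nonneg hsN fun τ _ => by positivity
      linarith
    have h2 : χ (⌊s⌋₊ + 1) (x s) = 1 :=
      (χ (⌊s⌋₊ + 1)).one_of_mem_closedBall (mem_closedBall_zero_iff.2 (hR _ _ h1))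
    simp only [H, h2, one_smul, hdt s hs]
  refine ⟨x, hx0, fun T hT => ⟨hxc.continuousOn, ?_, fun t ht => ?_⟩⟩
  · refine (hxint 0 T).congr fun s hs => ?_
    rw [uIoc_of_le hT] at hs
    exact hHF s hs.1.le
  · rw [hx0, hx t ht.1]
    congr 1
    refine intervalIntegral.integral_congr fun s hs => ?_
    rw [uIcc_of_le ht.1] at hs
    exact hHF s hs.1

/-- An iISS Lyapunov function with linear disturbance gain makes an affine system iISS. -/
theorem isIISS_of_dissipation {n m : ℕ} {F₀ : Euc n → Euc n} {g : Fin m → Euc n → Euc n}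
    (hF₀ : ContDiff ℝ 1 F₀) (hg : ∀ i, ContDiff ℝ 1 (g i)) {W : Euc n → ℝ}
    (hW : ContDiff ℝ 1 W) (hWpos : PosDefFun W) (hWu : RadiallyUnbounded W) {α : ℝ → ℝ} {c : ℝ}
    (hα : ContinuousOn α (Ici 0)) (hα0 : α 0 = 0) (hαpos : ∀ r, 0 < r → 0 < α r) (hc : 0 ≤ c)
    (hdec : ∀ x d, fderiv ℝ W x (F₀ x + inputMap g x d) ≤ -α ‖x‖ + c * ‖d‖) :
    IsIISS fun x d => F₀ x + inputMap g x d := by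
  refine ⟨fun d hd x₀ => exists_global_trajectory hF₀ hg hW hWu hc (fun x d => ?_) hd x₀,
    exists_iISS_estimate hW hWpos hWu hα hα0 hαpos hc hdec⟩
  have h := hdec x d
  rcases (norm_nonneg x).eq_or_lt with h0 | h0
  · rw [← h0, hα0] at h
    linarith
  · linarith [hαpos _ h0]

/-! ### Lie derivatives and the choice of the weight -/

theorem fderiv_inputMap {n m : ℕ} (g : Fin m → Euc n → Euc n) (W : Euc n → ℝ) (x : Euc n)
    (u : Euc m) : fderiv ℝ W x (inputMap g x u) = inner ℝ (lieDVec g W x) u := by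
  simp [inputMap, lieDVec, lieD, PiLp.inner_apply]

theorem contDiff_lieD {n : ℕ} {k : ℕ∞} {X : Euc n → Euc n} {W : Euc n → ℝ} (hX : ContDiff ℝ k X)
    (hW : ContDiff ℝ ∞ W) : ContDiff ℝ k (lieD X W) :=
  (hW.fderiv_right (m := k) (by exact_mod_cast le_top)).clm_apply hX

theorem contDiff_lieDVec {n m : ℕ} {k : ℕ∞} {g : Fin m → Euc n → Euc n} {W : Euc n → ℝ}
    (hg : ∀ i, ContDiff ℝ k (g i)) (hW : ContDiff ℝ ∞ W) : ContDiff ℝ k (lieDVec g W) :=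
  contDiff_euclidean.2 fun i => contDiff_lieD (hg i) hW

theorem contDiff_inputMap {n m : ℕ} {g : Fin m → Euc n → Euc n} (hg : ∀ i, ContDiff ℝ 1 (g i))
    {u : Euc n → Euc m} (hu : ContDiff ℝ 1 u) : ContDiff ℝ 1 fun x => inputMap g x (u x) := by
  unfold inputMap
  exact ContDiff.sum fun i _ => (contDiff_euclidean.1 hu i).smul (hg i)

theorem PosDefFun.fderiv_zero {n : ℕ} {W : Euc n → ℝ} (hW : PosDefFun W) : fderiv ℝ W 0 = 0 :=
  IsLocalMin.fderiv_eq_zero (Eventually.of_forall fun x => by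
    rw [hW.1]
    exact hW.nonneg x)

/-- A flat weight `δ` for which `V + δ(V) L` is a perturbation of `V` that decreases strictly
along the closed loop. -/
theorem exists_flat_weight {n m : ℕ} {V L A C : Euc n → ℝ} {b E : Euc n → Euc m} {D ξ : ℝ → ℝ}
    (hV : Continuous V) (hVpos : PosDefFun V) (hVu : RadiallyUnbounded V) (hL : Continuous L)
    (hA : Continuous A) (hC : Continuous C) (hb : Continuous b) (hE : Continuous E)
    (hD : Continuous D) (hDpos : ∀ s, 0 < D s) (hξ : Continuous ξ) (hξpos : ∀ s, 0 < ξ s)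
    (hA0 : ∀ x, A x ≤ 0) (hbAC : ∀ x, b x = 0 → x ≠ 0 → C x < 0 ∨ A x < 0) :
    ∃ δ : ℝ → ℝ, ContDiff ℝ ∞ δ ∧ δ 0 = 0 ∧ (∀ s, 0 ≤ δ s) ∧ ∀ x, x ≠ 0 → 0 < δ (V x) ∧
      |deriv δ (V x) * L x| < 1 / 2 ∧ V x / 2 < V x + δ (V x) * L x ∧
      D (V x) < 2 * D (V x + δ (V x) * L x) ∧ δ (V x) * ‖E x‖ < D (V x) ∧
      (1 + deriv δ (V x) * L x) * (A x - ξ (V x) * ‖b x‖ ^ 2) +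
        δ (V x) * (C x - ξ (V x) * inner ℝ (E x) (b x)) < 0 := by
  -- In the application `L`, `A`, `C`, `b`, `E` are `L_GV`, `L_fV`, `L_fL_GV`, `L_gV`, `L_gL_GV`,
  -- and `z` is the pair `(δ(V), δ'(V))`.
  let Good : ℝ × ℝ → Euc n → Prop := fun z x => |z.2 * L x| < 1 / 2 ∧ V x / 2 < V x + z.1 * L x ∧
      D (V x) < 2 * D (V x + z.1 * L x) ∧ z.1 * ‖E x‖ < D (V x) ∧
      (1 + z.2 * L x) * (A x - ξ (V x) * ‖b x‖ ^ 2) +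
        z.1 * (C x - ξ (V x) * inner ℝ (E x) (b x)) < 0
  have hgood : ∀ x₀, x₀ ≠ 0 → ∀ᶠ z : (ℝ × ℝ) × Euc n in 𝓝 ((0, 0), x₀),
      0 < z.1.1 → Good z.1 z.2 := by
    intro x₀ hx₀
    have hVx := hVpos.2 x₀ hx₀
    have hDx := hDpos (V x₀)
    have hsub : ∀ x, A x - ξ (V x) * ‖b x‖ ^ 2 ≤ 0 := fun x => by
      have := mul_nonneg (hξpos (V x)).le (sq_nonneg ‖b x‖)
      linarith [hA0 x]
    have e1 : ∀ᶠ z : (ℝ × ℝ) × Euc n in 𝓝 ((0, 0), x₀), |z.1.2 * L z.2| < 1 / 2 :=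
      Continuous.continuousAt (by fun_prop) |>.eventually_lt continuousAt_const (by simp)
    have e2 : ∀ᶠ z : (ℝ × ℝ) × Euc n in 𝓝 ((0, 0), x₀), V z.2 / 2 < V z.2 + z.1.1 * L z.2 :=
      Continuous.continuousAt (by fun_prop) |>.eventually_lt
        (Continuous.continuousAt (by fun_prop)) (by simpa using hVx)
    have e3 : ∀ᶠ z : (ℝ × ℝ) × Euc n in 𝓝 ((0, 0), x₀),
        D (V z.2) < 2 * D (V z.2 + z.1.1 * L z.2) :=
      Continuous.continuousAt (by fun_prop) |>.eventually_lt
        (Continuous.continuousAt (by fun_prop)) (by simp; linarith)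
    have e4 : ∀ᶠ z : (ℝ × ℝ) × Euc n in 𝓝 ((0, 0), x₀), z.1.1 * ‖E z.2‖ < D (V z.2) :=
      Continuous.continuousAt (by fun_prop) |>.eventually_lt
        (Continuous.continuousAt (by fun_prop)) (by simpa using hDx)
    have e5 : ∀ᶠ z : (ℝ × ℝ) × Euc n in 𝓝 ((0, 0), x₀), 0 < z.1.1 →
        (1 + z.1.2 * L z.2) * (A z.2 - ξ (V z.2) * ‖b z.2‖ ^ 2) +
          z.1.1 * (C z.2 - ξ (V z.2) * inner ℝ (E z.2) (b z.2)) < 0 := by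
      -- If `V` strictly decreases at `x₀`, continuity at `z = 0` suffices. Otherwise the expression
      -- is zero at `z = 0`, and its sign comes from `C x₀ < 0` with the positivity of `z.1`.
      by_cases h : A x₀ - ξ (V x₀) * ‖b x₀‖ ^ 2 < 0
      · have : ∀ᶠ z : (ℝ × ℝ) × Euc n in 𝓝 ((0, 0), x₀),
            (1 + z.1.2 * L z.2) * (A z.2 - ξ (V z.2) * ‖b z.2‖ ^ 2) +
              z.1.1 * (C z.2 - ξ (V z.2) * inner ℝ (E z.2) (b z.2)) < 0 :=
          Continuous.continuousAt (by fun_prop) |>.eventually_lt continuousAt_const (by simpa using h)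
        exact this.mono fun z hz _ => hz
      · have hzero := le_antisymm (hsub x₀) (not_lt.1 h)
        have hsq := mul_nonneg (hξpos (V x₀)).le (sq_nonneg ‖b x₀‖)
        have hA' : A x₀ = 0 := by linarith [hA0 x₀]
        have hb' : b x₀ = 0 := by
          have : ξ (V x₀) * ‖b x₀‖ ^ 2 = 0 := by linarith
          simpa [(hξpos (V x₀)).ne'] using this
        have hC' : C x₀ < 0 := (hbAC x₀ hb' hx₀).resolve_right hA'.not_lt
        have : ∀ᶠ z : (ℝ × ℝ) × Euc n in 𝓝 ((0, 0), x₀),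
            C z.2 - ξ (V z.2) * inner ℝ (E z.2) (b z.2) < 0 :=
          Continuous.continuousAt (by fun_prop) |>.eventually_lt continuousAt_const
            (by simpa [hb'] using hC')
        filter_upwards [this, e1] with z hz h1 hp
        have h2 := (abs_lt.1 h1).1
        have h3 := mul_neg_of_pos_of_neg hp hz
        have h4 := mul_nonpos_of_nonneg_of_nonpos (show 0 ≤ 1 + z.1.2 * L z.2 by linarith)
          (hsub z.2)
        linarith
    filter_upwards [e1, e2, e3, e4, e5] with z h1 h2 h3 h4 h5 hp
    exact ⟨h1, h2, h3, h4, h5 hp⟩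
  obtain ⟨δ, hδ, hδ0, hδP⟩ := exists_contDiff_flat_of_locally_small
    (fun s p q => ∀ x, V x = s → Good (p, q) x) fun a c ha => by
      have hS := hVu.isCompact_preimage_Icc hV a c
      -- Compactness of the shell turns pointwise neighbourhoods into one bound on `(p, q)` valid
      -- for all its points.
      have h := hS.eventually_forall_of_forall_eventually (x₀ := ((0 : ℝ), (0 : ℝ)))
        (P := fun z x => 0 < z.1 → Good z x) fun x hx => hgood x (by
          rintro rfl
          have := hx.1
          rw [hVpos.1] at this
          linarith)
      obtain ⟨r, hr, hr'⟩ := Metric.eventually_nhds_iff.1 h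
      refine ⟨r / 2, half_pos hr, fun s hs p q hp hpr hqr x hx => hr' ?_ x ?_ hp⟩
      · rw [Prod.dist_eq, Real.dist_eq, Real.dist_eq, sub_zero, sub_zero, abs_of_pos hp]
        exact max_lt (by linarith) (by linarith)
      · rwa [mem_preimage, hx]
  refine ⟨δ, hδ, hδ0 0 le_rfl, fun s => ?_, fun x hx => ?_⟩
  · rcases le_or_gt s 0 with hs | hs
    · exact (hδ0 s hs).ge
    · exact (hδP s hs).1.le
  obtain ⟨h1, h2⟩ := hδP (V x) (hVpos.2 x hx)
  exact ⟨h1, h2 x rfl⟩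

/-! ### The rescaled Lyapunov function and the theorem -/

/-- The primitive of the reciprocal of a smooth positive function on a half line. -/
theorem contDiffOn_integral_one_div {D Db : ℝ → ℝ} (hD : ContDiffOn ℝ ∞ D (Ici 0))
    (hDb : Continuous Db) (hDbpos : ∀ s, 0 < Db s) (hDDb : ∀ s, 0 ≤ s → Db s = D s) :
    (∀ u, HasDerivAt (fun u => ∫ p in (0 : ℝ)..u, 1 / Db p) (1 / Db u) u) ∧
      ContDiffOn ℝ ∞ (fun u => ∫ p in (0 : ℝ)..u, 1 / Db p) (Ici 0) := by
  have hc : Continuous fun p => 1 / Db p := continuous_const.div hDb fun s => (hDbpos s).ne'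
  have hd : ∀ u, HasDerivAt (fun u => ∫ p in (0 : ℝ)..u, 1 / Db p) (1 / Db u) u := fun u =>
    (hc.integral_hasStrictDerivAt 0 u).hasDerivAt
  refine ⟨hd, (contDiffOn_infty_iff_derivWithin (uniqueDiffOn_Ici 0)).2
    ⟨fun u _ => (hd u).differentiableAt.differentiableWithinAt, ?_⟩⟩
  have h1 : ContDiffOn ℝ ∞ (fun u => 1 / D u) (Ici 0) :=
    contDiffOn_const.div hD fun s hs => by
      rw [← hDDb s hs]
      exact (hDbpos s).ne'
  refine h1.congr fun u hu => ?_
  rw [(hd u).hasDerivWithinAt.derivWithin (uniqueDiffOn_Ici 0 u hu), hDDb u hu]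

theorem mainTheorem2 (n m : ℕ)
    (f : Euc n → Euc n) (g : Fin m → Euc n → Euc n)
    (hf : ContDiff ℝ 1 f) (hf0 : f 0 = 0) (hg : ∀ i, ContDiff ℝ 1 (g i))
    (V : Euc n → ℝ) (hV : ContDiff ℝ ∞ V) (hVpos : PosDefFun V) (hVrad : RadiallyUnbounded V)
    (hfV : ∀ x, lieD f V x ≤ 0)
    (G : Euc n → Euc n) (hG : ContDiff ℝ ∞ G)
    (hGV : ∀ x, lieDVec g V x = 0 → x ≠ 0 → lieD f (lieD G V) x < 0 ∨ lieD f V x < 0)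
    (D : ℝ → ℝ) (hD : ContDiffOn ℝ ∞ D (Ici 0)) (hDpos : ∀ s, 0 ≤ s → 0 < D s)
    (hDmono : MonotoneOn D (Ici 0))
    (hDint : Tendsto (fun R : ℝ => ∫ s in (0 : ℝ)..R, 1 / D s) atTop atTop)
    (hgV : ∀ x, ‖lieDVec g V x‖ ≤ D (V x))
    (ε : ℝ) (hε : 0 < ε) :
    ∃ δ ξ : ℝ → ℝ,
      ContDiffOn ℝ ∞ δ (Ici 0) ∧ (∀ s, 0 ≤ s → 0 ≤ δ s) ∧
      ContDiffOn ℝ ∞ ξ (Ici 0) ∧ (∀ s, 0 ≤ s → 0 ≤ ξ s) ∧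
      (∀ x, ‖feedbackK g V ξ x‖ ≤ ε) ∧
      IsIISS (actuatorSystem f g (feedbackK g V ξ)) ∧
      (∀ x, 0 ≤ candidateU V G δ x) ∧
      IsSmoothIISSCLF (actuatorSystem f g (feedbackK g V ξ))
        (fun x => ∫ p in (0 : ℝ)..candidateU V G δ x, 1 / D p) := by
  -- The constant continuation makes the primitive differentiable on the whole line, so the chain
  -- rule for `Φ ∘ U` also holds at the origin, where `U = 0`.
  let Db : ℝ → ℝ := fun s => D (max s 0)
  have hDbc : Continuous Db := hD.continuousOn.comp_continuous (by fun_prop) fun s =>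
    le_max_right s 0
  have hDbpos : ∀ s, 0 < Db s := fun s => hDpos _ (le_max_right s 0)
  have hDDb : ∀ s, 0 ≤ s → Db s = D s := fun s hs => by simp only [Db, max_eq_left hs]
  have hDV : ∀ x, Db (V x) = D (V x) := fun x => hDDb _ (hVpos.nonneg x)
  have hL : ContDiff ℝ ∞ (lieD G V) := contDiff_lieD (k := ⊤) hG hV
  have hb : ContDiff ℝ 1 (lieDVec g V) := contDiff_lieDVec (k := 1) hg hV
  have hE : ContDiff ℝ 1 (lieDVec g (lieD G V)) := contDiff_lieDVec (k := 1) hg hL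
  have hA : ContDiff ℝ 1 (lieD f V) := contDiff_lieD (k := 1) hf hV
  have hC : ContDiff ℝ 1 (lieD f (lieD G V)) := contDiff_lieD (k := 1) hf hL
  obtain ⟨δ, hδ, hδ0, hδ_nonneg, hδx⟩ := exists_flat_weight (ξ := fun s => ε / Db s) hV.continuous hVpos hVrad
    hL.continuous hA.continuous hC.continuous hb.continuous hE.continuous hDbc hDbpos
    (continuous_const.div hDbc fun s => (hDbpos s).ne') (fun s => div_pos hε (hDbpos s)) hfV hGV
  let ξ : ℝ → ℝ := fun s => ε / D s
  have hξV : ∀ x, ξ (V x) = ε / Db (V x) := fun x => by simp only [ξ, hDV]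
  have hξ : ContDiffOn ℝ ∞ ξ (Ici 0) := contDiffOn_const.div hD fun s hs => (hDpos s hs).ne'
  have hξ_nonneg : ∀ s, 0 ≤ s → 0 ≤ ξ s := fun s hs => (div_pos hε (hDpos s hs)).le
  let K := feedbackK g V ξ
  have hK : ContDiff ℝ 1 K := by
    have h1 : ContDiff ℝ 1 fun x => ξ (V x) :=
      (hξ.of_le (by exact_mod_cast le_top)).comp_contDiff (hV.of_le (by exact_mod_cast le_top))
        fun x => hVpos.nonneg x
    exact (h1.smul hb).neg
  have hV0 : fderiv ℝ V 0 = 0 := hVpos.fderiv_zero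
  have hb0 : lieDVec g V 0 = 0 := by
    ext i
    simp [lieDVec, lieD, hV0]
  have hK0 : K 0 = 0 := by simp [K, feedbackK, hb0]
  let F₀ : Euc n → Euc n := fun x => f x + inputMap g x (K x)
  have hF₀ : ContDiff ℝ 1 F₀ := hf.add (contDiff_inputMap hg hK)
  have hF₀0 : F₀ 0 = 0 := by simp [F₀, hf0, hK0, inputMap]
  have hF : actuatorSystem f g K = fun x d => F₀ x + inputMap g x d := by
    funext x d
    simp only [actuatorSystem, F₀, inputMap_add, add_assoc]
  let U := candidateU V G δ
  have hU : ContDiff ℝ ∞ U := hV.add ((hδ.comp hV).mul hL)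
  have hU0 : U 0 = 0 := by simp [U, candidateU, hVpos.1, hδ0]
  have hUV : ∀ x, V x / 2 ≤ U x := fun x => by
    rcases eq_or_ne x 0 with rfl | hx
    · rw [hU0, hVpos.1, zero_div]
    · exact (hδx x hx).2.2.1.le
  have hU_nonneg : ∀ x, 0 ≤ U x := fun x => (div_nonneg (hVpos.nonneg x) two_pos.le).trans (hUV x)
  have hUd : ∀ x, HasFDerivAt U ((1 + deriv δ (V x) * lieD G V x) • fderiv ℝ V x +
      δ (V x) • fderiv ℝ (lieD G V) x) x := by
    intro x
    have h1 : HasFDerivAt V (fderiv ℝ V x) x := (hV.differentiable (by simp) x).hasFDerivAt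
    have h2 : HasFDerivAt (lieD G V) (fderiv ℝ (lieD G V) x) x :=
      (hL.differentiable (by simp) x).hasFDerivAt
    have h3 : HasDerivAt δ (deriv δ (V x)) (V x) :=
      (hδ.differentiable (by simp) (V x)).hasDerivAt
    refine (h1.add ((h3.comp_hasFDerivAt x h1).mul h2)).congr_fderiv ?_
    ext v
    simp
    ring
  obtain ⟨hΦd, hΦ⟩ := contDiffOn_integral_one_div hD hDbc hDbpos hDDb
  set Φ : ℝ → ℝ := fun u => ∫ p in (0 : ℝ)..u, 1 / Db p with hΦdef
  have hΦD : ∀ u, 0 ≤ u → ∫ p in (0 : ℝ)..u, 1 / D p = Φ u := fun u hu => by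
    refine intervalIntegral.integral_congr fun p hp => ?_
    rw [uIcc_of_le hu] at hp
    simp only [hDDb p hp.1]
  have hΦmono : StrictMono Φ := strictMono_of_deriv_pos fun u => by
    rw [(hΦd u).deriv]
    exact one_div_pos.2 (hDbpos u)
  have hΦ0 : Φ 0 = 0 := intervalIntegral.integral_same
  have hΦtop : Tendsto Φ atTop atTop :=
    hDint.congr' ((eventually_ge_atTop 0).mono fun u hu => hΦD u hu)
  let W : Euc n → ℝ := fun x => Φ (U x)
  have hWeq : (fun x => ∫ p in (0 : ℝ)..candidateU V G δ x, 1 / D p) = W :=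
    funext fun x => hΦD _ (hU_nonneg x)
  have hW : ContDiff ℝ ∞ W := hΦ.comp_contDiff hU hU_nonneg
  have hWpos : PosDefFun W := by
    refine ⟨by simp only [W, hU0, hΦ0], fun x hx => ?_⟩
    rw [← hΦ0]
    exact hΦmono ((half_pos (hVpos.2 x hx)).trans_le (hUV x))
  have hWu : RadiallyUnbounded W :=
    hΦtop.comp (tendsto_atTop_mono hUV (hVrad.atTop_div_const two_pos))
  have hWd : ∀ x v, fderiv ℝ W x v = 1 / Db (U x) * ((1 + deriv δ (V x) * lieD G V x) *
      fderiv ℝ V x v + δ (V x) * fderiv ℝ (lieD G V) x v) := fun x v => by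
    have h1 : HasFDerivAt W _ x := (hΦd (U x)).comp_hasFDerivAt x (hUd x)
    rw [h1.fderiv]
    simp
    ring
  have hF₀V : ∀ Q : Euc n → ℝ, ∀ x, fderiv ℝ Q x (F₀ x) =
      lieD f Q x - ε / Db (V x) * inner ℝ (lieDVec g Q x) (lieDVec g V x) := fun Q x => by
    simp only [F₀, map_add, fderiv_inputMap, K, feedbackK, inner_neg_right, inner_smul_right, hξV,
      lieD]
    ring
  let w : Euc n → ℝ := fun x => -fderiv ℝ W x (F₀ x)
  have hw : Continuous w :=
    ((hW.continuous_fderiv (by simp)).clm_apply hF₀.continuous).neg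
  have hwpos : PosDefFun w := by
    refine ⟨by simp [w, hF₀0], fun x hx => ?_⟩
    obtain ⟨-, -, -, -, -, h⟩ := hδx x hx
    simp only [w]
    rw [hWd, hF₀V, hF₀V, real_inner_self_eq_norm_sq, neg_pos]
    exact mul_neg_of_pos_of_neg (one_div_pos.2 (hDbpos _)) h
  -- Taking `P` to be the norm and `y = ‖x‖` yields a radial lower bound for the decay rate `w`.
  obtain ⟨α, hα, hα0, hαpos, hαw⟩ := exists_lipschitz_posDef_minorant hw hwpos continuous_norm
    (posDefFun_norm n) (radiallyUnbounded_norm n)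
  -- The constant: `L_gV` contributes `3/2` and `δ(V) L_gL_GV` contributes 1, in units of `D(V)‖d‖`,
  -- and `D(V) ≤ 2 D(U)`.
  have hgain : ∀ x d, fderiv ℝ W x (inputMap g x d) ≤ 5 * ‖d‖ := by
    intro x d
    rw [hWd, fderiv_inputMap, fderiv_inputMap]
    rcases eq_or_ne x 0 with rfl | hx
    · rw [hb0, hVpos.1, hδ0]
      simp
    · obtain ⟨h1, h2, -, h4, h5, -⟩ := hδx x hx
      have hq := abs_lt.1 h2
      have i1 : inner ℝ (lieDVec g V x) d ≤ Db (V x) * ‖d‖ :=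
        (real_inner_le_norm _ _).trans (mul_le_mul_of_nonneg_right
          ((hgV x).trans_eq (hDV x).symm) (norm_nonneg d))
      have i2 : δ (V x) * inner ℝ (lieDVec g (lieD G V) x) d ≤ Db (V x) * ‖d‖ := by
        refine (mul_le_mul_of_nonneg_left (real_inner_le_norm _ _) h1.le).trans ?_
        rw [← mul_assoc]
        exact mul_le_mul_of_nonneg_right h5.le (norm_nonneg d)
      have i3 : (1 + deriv δ (V x) * lieD G V x) * inner ℝ (lieDVec g V x) d ≤
          3 / 2 * (Db (V x) * ‖d‖) :=
        (mul_le_mul_of_nonneg_left i1 (by linarith)).trans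
          (mul_le_mul_of_nonneg_right (by linarith) (mul_nonneg (hDbpos _).le (norm_nonneg d)))
      have i4 : Db (V x) * ‖d‖ ≤ 2 * Db (U x) * ‖d‖ :=
        mul_le_mul_of_nonneg_right h4.le (norm_nonneg d)
      rw [one_div, inv_mul_le_iff₀ (hDbpos _)]
      nlinarith
  have hdec : ∀ x d, fderiv ℝ W x (F₀ x + inputMap g x d) ≤ -α ‖x‖ + 5 * ‖d‖ := by
    intro x d
    have h1 := hαw x ‖x‖ (half_le_self (norm_nonneg x)) le_rfl
    have h2 := hgain x d
    simp only [w] at h1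
    rw [map_add]
    linarith
  refine ⟨δ, ξ, hδ.contDiffOn, fun s _ => hδ_nonneg s, hξ, hξ_nonneg, fun x => ?_, ?_, hU_nonneg, ?_⟩
  · rw [feedbackK, norm_neg, norm_smul, Real.norm_of_nonneg (hξ_nonneg _ (hVpos.nonneg x))]
    simp only [ξ]
    rw [div_mul_eq_mul_div, div_le_iff₀ (hDpos _ (hVpos.nonneg x))]
    exact mul_le_mul_of_nonneg_left (hgV x) hε.le
  · change IsIISS (actuatorSystem f g K)
    rw [hF]
    exact isIISS_of_dissipation hF₀ hg (hW.of_le (by exact_mod_cast le_top)) hWpos hWu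
      hα.continuous.continuousOn hα0 hαpos (by norm_num) hdec
  · change IsSmoothIISSCLF (actuatorSystem f g K) _
    rw [hF, hWeq]
    refine ⟨hW, hWpos, hWu, α, fun r => 5 * r, hα.continuous.continuousOn, hα0, hαpos,
      ⟨by fun_prop, fun r _ s _ hrs => mul_lt_mul_of_pos_left hrs (by norm_num), by simp⟩, hdec⟩
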